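/- Let $d\ge 1$ and let $P$ be a simple, stationary (in law) determinantal point process on $\mathbb R^d$ with measurable kernel $K:\mathbb R^d\times\mathbb R^d\to\mathbb C$: for every $n\ge 1$ and every measurable $\varphi\ge 0$, $$\mathbf E\sum^{\neq}_{x_1,\dots,x_n\in P}\varphi(x_1,\dots,x_n)=\int\varphi\,\rho_n,\qquad \rho_n(x_1,\dots,x_n)=\det\big(K(x_i,x_j)\big)_{1\le i,j\le n},$$ the sum being over $n$-tuples of pairwise distinct points. Assume that every matrix $(K(x_i,x_j))_{i,j}$ is Hermitian positive semidefinite, that $K(0,0)=1$ (unit intensity), that $K$ is a version of the kernel for which $\rho_n(x_1,\dots,x_n)=\rho_n(x_1-x_n,\dots,x_{n-1}-x_n,0)$ for all $n\ge 1$ and almost all $(x_1,\dots,x_n)$, and that $\kappa(x)=|K(0,x)|$ is square integrable. Put $s(u)=1-\widehat{\kappa^2}(u)$ with $\widehat f(u)=\int e^{-i\langle u,x\rangle}f(x)\,dx$. Definitions. Let $A\subset\mathbb R^d$ be a convex body (compact, convex, with non-empty interior). For a bounded measurable function $\gamma$ on $A$, $P$ is *(linearly) $\gamma$-rigid on $A$*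 if there are bounded measurable compactly supported functions $h_n:\mathbb R^d\to\mathbb C$ vanishing on $A$ such that $\sum_{x\in P}h_n(x)\to\sum_{x\in P\cap A}\gamma(x)$ almost surely and in $L^2$. For $k\in\mathbb N^d$, $P$ is *$k$-rigid on $A$* if it is $\gamma$-rigid for $\gamma(t)=t^k=\prod_i t_i^{k_i}$. The function $s^{-1}$ *has a pole of order $k$ at $0$* if every polynomial $Q(u)=\sum_m a_m u^m$ with complex coefficients such that $\int_{B(0,\varepsilon)}|Q|^2s^{-1}<\infty$ for some $\varepsilon>0$ satisfies $a_k=0$. A polynomial $Q=\sum_m a_mt^m$ with complex coefficients is a *$k$-polynomial* if there is $k_0\in\mathbb N^d$ with $k_0\ge k$ coordinatewise, $a_{k_0}\neq0$, and $m\le k_0$ coordinatewise whenever $a_m\ne0$. Then for every $k\in\mathbb N^d$ and every convex body $A$, $P$ is $k$-rigid on $A$ if and only if $(1-\widehat{\kappa^2})^{-1}$ has a pole of order $k$ at $0$. If it does not have a pole of order $k$ at $0$, then $P$ is not $Q$-rigid on $A$ for any $k$-polynomial $Q$. -/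

import Mathlib

open MeasureTheory Filter Topology
open scoped ENNReal ComplexOrder

noncomputable section

namespace RigidDPP

/-- The Euclidean space `ℝ^d`. -/
abbrev E (d : ℕ) : Type := EuclideanSpace ℝ (Fin d)

/-! ### Point processes -/

/-- Simple point configurations in `ℝ^d`: sets with finitely many points in every compact set
(equivalently, sets without accumulation points). -/
def Configuration (d : ℕ) : Type :=
  {S : Set (E d) // ∀ C : Set (E d), IsCompact C → (S ∩ C).Finite}

/-- Number of points of a configuration in `C` (used for compact `C`). -/
def count {d : ℕ} (C : Set (E d)) (S : Configuration d) : ℕ := (S.1 ∩ C).ncard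

/-- The counting `σ`-algebra: the one generated by the maps `S ↦ #(S ∩ C)`, `C` compact. -/
instance {d : ℕ} : MeasurableSpace (Configuration d) :=
  ⨆ C : {C : Set (E d) // IsCompact C}, MeasurableSpace.comap (count C.1) ⊤

/-- The translated configuration `S + t`. -/
def shift {d : ℕ} (t : E d) (S : Configuration d) : Configuration d :=
  ⟨(fun x => x + t) '' S.1, fun C hC => by
    have h : ((fun x : E d => x + t) '' S.1) ∩ C
        = (fun x => x + t) '' (S.1 ∩ ((fun x => x + (-t)) '' C)) := by
      ext y
      constructor
      · rintro ⟨⟨x, hx, rfl⟩, hy⟩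
        exact ⟨x, ⟨hx, ⟨x + t, hy, by simp⟩⟩, rfl⟩
      · rintro ⟨x, ⟨hx, ⟨z, hz, hzx⟩⟩, rfl⟩
        refine ⟨⟨x, hx, rfl⟩, ?_⟩
        have : x + t = z := by rw [← hzx]; simp
        simpa [this] using hz
    rw [h]
    exact (S.2 _ (hC.image (by fun_prop))).image _⟩

/-- A point process is stationary if its law is invariant under all translations. -/
def IsStationary {d : ℕ} {Ω : Type*} [MeasurableSpace Ω] (μ : Measure Ω)
    (P : Ω → Configuration d) : Prop :=
  ∀ t : E d, μ.map (fun ω => shift t (P ω)) = μ.map P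

/-- The linear statistic `I(f) = ∑_{x ∈ S} f(x)`; only used for `f` with bounded support, where the
sum has finitely many nonzero terms. -/
def linStat {d : ℕ} (f : E d → ℂ) (S : Configuration d) : ℂ := ∑' x : S.1, f x

/-! ### Determinantal point processes -/

/-- `det (K(x_i, x_j))_{1 ≤ i, j ≤ n}`. -/
def corrDet {d : ℕ} (K : E d → E d → ℂ) {n : ℕ} (x : Fin n → E d) : ℂ :=
  (Matrix.of fun i j => K (x i) (x j)).det

/-- `K` is a Hermitian positive kernel: every matrix `(K(x_i, x_j))` is Hermitian and positive
semidefinite. -/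
def IsHermitianPositive {d : ℕ} (K : E d → E d → ℂ) : Prop :=
  ∀ (n : ℕ) (x : Fin n → E d), (Matrix.of fun i j => K (x i) (x j)).PosSemidef

/-- `P` is determinantal with kernel `K`: for each `n ≥ 1` the `n`-point correlation function of `P`
is `det (K(x_i, x_j))`, i.e. for all measurable `φ ≥ 0`,
`𝔼 ∑ φ(x_1, …, x_n) = ∫ φ(x) det (K(x_i, x_j)) dx`, the sum being over `n`-tuples of pairwise
distinct points of `P`. (For Hermitian positive `K` the determinant is a nonnegative real.) -/
def IsDeterminantal {d : ℕ} {Ω : Type*} [MeasurableSpace Ω] (μ : Measure Ω)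
    (P : Ω → Configuration d) (K : E d → E d → ℂ) : Prop :=
  ∀ n : ℕ, 1 ≤ n → ∀ φ : (Fin n → E d) → ℝ≥0∞, Measurable φ →
    ∫⁻ ω, ∑' x : {x : Fin n → E d // Function.Injective x ∧ ∀ i, x i ∈ (P ω).1}, φ x.1 ∂μ
      = ∫⁻ x, ENNReal.ofReal (corrDet K x).re * φ x

/-- The version of the kernel is adapted to stationarity: for each `n`, the correlation functions
`ρ_n(x_1, …, x_n) = det (K(x_i, x_j))` satisfy
`ρ_n(x_1, …, x_n) = ρ_n(x_1 - x_n, …, x_{n-1} - x_n, 0)` for almost every `(x_1, …, x_n)`.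
Correlation functions are only determined almost everywhere by the process, whereas
the function `K(0, ·)` lives on a null set of pairs; this ties the two together. -/
def HasStationaryCorrelations {d : ℕ} (K : E d → E d → ℂ) : Prop :=
  ∀ n : ℕ, ∀ᵐ x : Fin (n + 1) → E d,
    corrDet K x = corrDet K (fun i => x i - x (Fin.last n))

/-- The Fourier transform `u ↦ ∫ exp(-i⟨u, x⟩) f(x) dx`. -/
def fourierTransform {d : ℕ} (f : E d → ℂ) (u : E d) : ℂ :=
  ∫ x, Complex.exp (-(Complex.I * ((inner ℝ u x : ℝ) : ℂ))) * f x

/-- The reduced kernel `κ(x) = |K(0, x)|`. -/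
def reducedKernel {d : ℕ} (K : E d → E d → ℂ) (x : E d) : ℝ := ‖K 0 x‖

/-- `1 - (κ²)^(u)`. (The Fourier transform of `κ²` is real, as `κ` is even almost everywhere;
`re` only changes the type.) -/
def spectralDensity {d : ℕ} (K : E d → E d → ℂ) (u : E d) : ℝ :=
  1 - (fourierTransform (fun x => ((reducedKernel K x ^ 2 : ℝ) : ℂ)) u).re

/-! ### Poles -/

/-- The value of a polynomial in `d` variables at a point of `ℝ^d`. -/
def polyEval {d : ℕ} (Q : MvPolynomial (Fin d) ℂ) (t : E d) : ℂ :=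
  MvPolynomial.eval (fun i => ((t i : ℝ) : ℂ)) Q

/-- `s⁻¹` has a pole of multi-order `k` at `0`, for a function `s ≥ 0`: every polynomial
`Q = ∑ a_m u^m` with `∫_{B(0,ε)} |Q|² s⁻¹ < ∞` for some `ε > 0` satisfies `a_k = 0`.
The quotient is computed in `[0, ∞]`. -/
def HasPole {d : ℕ} (s : E d → ℝ) (k : Fin d →₀ ℕ) : Prop :=
  ∀ Q : MvPolynomial (Fin d) ℂ,
    (∃ ε : ℝ, 0 < ε ∧
      ∫⁻ u in Metric.ball (0 : E d) ε, ‖polyEval Q u‖ₑ ^ 2 / ENNReal.ofReal (s u) < ∞) →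
    Q.coeff k = 0

/-! ### Linear rigidity -/

/-- `P` is (linearly) `γ`-rigid on `A`: the statistic `∑_{x ∈ P ∩ A} γ(x)` is the limit, almost
surely and in `L²`, of linear statistics `I(h_n)` for bounded measurable compactly supported
functions `h_n` living on the complement of `A`. -/
def IsRigid {d : ℕ} {Ω : Type*} [MeasurableSpace Ω] (μ : Measure Ω)
    (P : Ω → Configuration d) (γ : E d → ℂ) (A : Set (E d)) : Prop :=
  ∃ h : ℕ → E d → ℂ,
    (∀ n, Measurable (h n) ∧ (∃ C : ℝ, ∀ x, ‖h n x‖ ≤ C) ∧ HasCompactSupport (h n) ∧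
      Function.support (h n) ⊆ Aᶜ) ∧
    (∀ᵐ ω ∂μ, Tendsto (fun n => linStat (h n) (P ω)) atTop (𝓝 (linStat (A.indicator γ) (P ω)))) ∧
    Tendsto (fun n => eLpNorm
      (fun ω => linStat (h n) (P ω) - linStat (A.indicator γ) (P ω)) 2 μ) atTop (𝓝 0)

/-- `Q`-rigidity on `A` for a polynomial `Q`. -/
def IsPolyRigid {d : ℕ} {Ω : Type*} [MeasurableSpace Ω] (μ : Measure Ω)
    (P : Ω → Configuration d) (Q : MvPolynomial (Fin d) ℂ) (A : Set (E d)) : Prop :=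
  IsRigid μ P (polyEval Q) A

/-- `k`-rigidity on `A` for a multi-index `k`, i.e. `γ`-rigidity for `γ(t) = t^k`. -/
def IsMultiRigid {d : ℕ} {Ω : Type*} [MeasurableSpace Ω] (μ : Measure Ω)
    (P : Ω → Configuration d) (k : Fin d →₀ ℕ) (A : Set (E d)) : Prop :=
  IsRigid μ P (fun t => ∏ i, ((t i : ℝ) : ℂ) ^ k i) A

/-- `Q = ∑ a_m t^m` is a `k`-polynomial: for some `k₀ ≥ k` (coordinatewise), `a_{k₀} ≠ 0` and every
`m` with `a_m ≠ 0` satisfies `m ≤ k₀`. -/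
def IsMultiPolynomial {d : ℕ} (k : Fin d →₀ ℕ) (Q : MvPolynomial (Fin d) ℂ) : Prop :=
  ∃ k₀ : Fin d →₀ ℕ, k ≤ k₀ ∧ Q.coeff k₀ ≠ 0 ∧ ∀ m, Q.coeff m ≠ 0 → m ≤ k₀

end RigidDPP

end

/-! Write σ = 1 - 𝓕(κ²). The pair correlation is 1 - κ²(x - y), so Plancherel gives E|I(f)|² = |∫
f|² + ∫ |𝓕 f|² σ (`integral_norm_linStat_sq`). Rigidity on A thus becomes a question of
approximation in the norm with weight σ on the Fourier side, by functions vanishing on A.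

The decisive fact is that σ vanishes at most quadratically. The variance of the number of points in
large balls is nonnegative, which forces ∫ κ² ≤ 1, and this implies σ(w) ≥ c min(1, |w|²)
(`exists_le_structureFactor`). Hence |u^k|²/s is bounded near 0 for every k ≠ 0. The only possible
pole has order 0, and it means that 1/s is not integrable at 0.

Pole implies rigidity, by duality (`exists_approx_indicator`). If 1_A were not in the closure, an
orthogonal vector ψ would yield an L² function G supported in A with 𝓕 G = √σ ψ and 𝓕 G(0) ≠ 0. As 𝓕
G is continuous, 1/σ ≤ const · |ψ|² would be integrable near 0. The term |∫ f|² is then removed by a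
correction spread thinly over a large region.

No pole excludes rigidity. By Cauchy–Schwarz with weights σ and 1/σ, Q-rigidity makes 1_A Q
orthogonal to every test function G supported in A with ∫ |𝓕 G|²/σ < ∞
(`IsRigid.integral_mul_conj_eq_zero`). If k = 0, then G = 1_A Q is admissible and Q = 0. If k ≠ 0,
take G = 1_A (Q - m) with m the mean of Q on A: then 𝓕 G(w) = O(|w|), which offsets the quadratic
zero of σ, and Q = m. Both contradict the nonzero coefficient at k₀ ≥ k. -/

namespace RigidDPP

open scoped FourierTransform SchwartzMap ContDiff ComplexConjugate

/-! ### Plancherel's theorem for Fourier integrals on L¹ ∩ L² -/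

section Plancherel

variable {V : Type*} [NormedAddCommGroup V] [InnerProductSpace ℝ V] [FiniteDimensional ℝ V]
  [MeasurableSpace V] [BorelSpace V]

theorem continuous_fourier {f : V → ℂ} (hf : Integrable f) : Continuous (𝓕 f) :=
  VectorFourier.fourierIntegral_continuous Real.continuous_fourierChar
    (by exact continuous_inner) hf

theorem norm_fourier_le (f : V → ℂ) (w : V) : ‖𝓕 f w‖ ≤ ∫ x, ‖f x‖ :=
  VectorFourier.norm_fourierIntegral_le_integral_norm _ _ _ _ _

theorem integral_fourier_smul_eq {f g : V → ℂ} (hf : Integrable f) (hg : Integrable g) :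
    ∫ w, 𝓕 f w • g w = ∫ x, f x • 𝓕 g x := by
  have := VectorFourier.integral_fourierIntegral_smul_eq_flip (μ := volume) (ν := volume)
    (e := Real.fourierChar) (L := innerₗ V) Real.continuous_fourierChar
    (by exact continuous_inner) hf hg
  rwa [flip_innerₗ] at this

/-- On `L¹ ∩ L²` the `L²` Fourier transform is given by the Fourier integral. -/
theorem fourier_toLp_ae_eq {f : V → ℂ} (h1 : Integrable f) (h2 : MemLp f 2) :
    ((𝓕 (h2.toLp f) : Lp ℂ 2 (volume : Measure V)) : V → ℂ) =ᵐ[volume] 𝓕 f := by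
  refine ae_eq_of_integral_contDiff_smul_eq
    ((Lp.memLp _).locallyIntegrable (by norm_num)) (continuous_fourier h1).locallyIntegrable
    fun g hg hgc => ?_
  have hgC : ContDiff ℝ ∞ fun x => (g x : ℂ) := Complex.ofRealCLM.contDiff.comp hg
  have hgCc : HasCompactSupport fun x => (g x : ℂ) := hgc.comp_left (g := Complex.ofReal) rfl
  let φ : 𝓢(V, ℂ) := hgCc.toSchwartzMap hgC
  have hφ : ∀ x, φ x = (g x : ℂ) := fun x => rfl
  -- The L² transform agrees with the distributional one, which is defined by moving 𝓕 onto the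
  -- Schwartz function; for integrable f the Fourier integral obeys the same duality.
  have e := congrArg (fun T => T φ) (Lp.fourier_toTemperedDistribution_eq (h2.toLp f))
  simp only [TemperedDistribution.fourier_apply, Lp.toTemperedDistribution_apply] at e
  have e1 : ∫ x, g x • ((𝓕 (h2.toLp f) : Lp ℂ 2 (volume : Measure V)) : V → ℂ) x
      = ∫ x, φ x • ((𝓕 (h2.toLp f) : Lp ℂ 2 (volume : Measure V)) : V → ℂ) x := by
    simp [hφ]
  rw [e1, ← e]
  have e2 : ∫ x, (𝓕 φ) x • (h2.toLp f) x = ∫ x, 𝓕 (φ : V → ℂ) x • f x := by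
    refine integral_congr_ae ?_
    filter_upwards [h2.coeFn_toLp] with x hx
    rw [hx, SchwartzMap.fourier_coe]
  rw [e2, integral_fourier_smul_eq φ.integrable h1]
  simp [hφ]

theorem memLp_fourier {f : V → ℂ} (h1 : Integrable f) (h2 : MemLp f 2) : MemLp (𝓕 f) 2 :=
  (memLp_congr_ae (fourier_toLp_ae_eq h1 h2)).1 (Lp.memLp _)

theorem integral_fourier_mul_conj {f g : V → ℂ} (hf1 : Integrable f) (hf2 : MemLp f 2)
    (hg1 : Integrable g) (hg2 : MemLp g 2) :
    ∫ w, 𝓕 f w * conj (𝓕 g w) = ∫ x, f x * conj (g x) := by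
  have h := Lp.inner_fourier_eq (hg2.toLp g) (hf2.toLp f)
  rw [L2.inner_def, L2.inner_def] at h
  have e1 : ∫ w, 𝓕 f w * conj (𝓕 g w) = ∫ w, inner ℂ (((𝓕 (hg2.toLp g) :
      Lp ℂ 2 (volume : Measure V)) : V → ℂ) w) (((𝓕 (hf2.toLp f) :
      Lp ℂ 2 (volume : Measure V)) : V → ℂ) w) := by
    refine integral_congr_ae ?_
    filter_upwards [fourier_toLp_ae_eq hf1 hf2, fourier_toLp_ae_eq hg1 hg2] with x h1 h2
    rw [h1, h2]; rfl
  have e2 : ∫ w, f w * conj (g w) = ∫ w, inner ℂ ((hg2.toLp g) w) ((hf2.toLp f) w) := by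
    refine integral_congr_ae ?_
    filter_upwards [hf2.coeFn_toLp, hg2.coeFn_toLp] with x h1 h2
    rw [h1, h2]; rfl
  rw [e1, e2, h]

theorem fourier_translate (f : V → ℂ) (z w : V) :
    𝓕 (fun x => f (x + z)) w = Real.fourierChar (inner ℝ z w) • 𝓕 f w :=
  congrFun (VectorFourier.fourierIntegral_comp_add_right Real.fourierChar volume (innerₗ V) f z) w

/-- The autocorrelation of `f`, integrated against `h`, in terms of the Fourier transforms. -/
theorem integral_mul_autocorrelation {f h : V → ℂ} (hf1 : Integrable f) (hf2 : MemLp f 2)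
    (hh : Integrable h) :
    ∫ z, h z * ∫ y, f (y + z) * conj (f y) = ∫ w, ((‖𝓕 f w‖ ^ 2 : ℝ) : ℂ) * 𝓕⁻ h w := by
  have hsq : Integrable fun w => ((‖𝓕 f w‖ ^ 2 : ℝ) : ℂ) :=
    ((memLp_fourier hf1 hf2).integrable_norm_pow (by norm_num)).ofReal
  -- Parseval for f(· + z) and f: translation becomes a character, so the autocorrelation is the
  -- inverse transform of |𝓕 f|². Fubini does the rest.
  have e1 : ∀ z, ∫ y, f (y + z) * conj (f y)
      = ∫ w, (Real.fourierChar (inner ℝ z w) : ℂ) * ((‖𝓕 f w‖ ^ 2 : ℝ) : ℂ) := fun z => by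
    have mp : MeasurePreserving (fun x : V => x + z) volume volume := measurePreserving_add_right _ z
    rw [← integral_fourier_mul_conj (hf1.comp_add_right z)
      (hf2.comp_measurePreserving mp) hf1 hf2]
    refine integral_congr_ae (Eventually.of_forall fun w => ?_)
    simp only [fourier_translate, Circle.smul_def, smul_eq_mul, mul_assoc, Complex.mul_conj]
    rw [Complex.normSq_eq_norm_sq]
  have hint : Integrable (fun p : V × V =>
      h p.1 * ((Real.fourierChar (inner ℝ p.1 p.2) : ℂ) * ((‖𝓕 f p.2‖ ^ 2 : ℝ) : ℂ)))
      (volume.prod volume) := by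
    have hb := hh.mul_prod hsq
    refine hb.mono ?_ (Eventually.of_forall fun p => ?_)
    · have hc : Continuous fun p : V × V => (Real.fourierChar (inner ℝ p.1 p.2) : ℂ) := by fun_prop
      exact (hh.1.comp_fst).mul (hc.aestronglyMeasurable.mul hsq.1.comp_snd)
    · rw [norm_mul, norm_mul, norm_mul, Circle.norm_coe, one_mul]
  simp_rw [e1, ← integral_const_mul]
  rw [integral_integral_swap hint]
  refine integral_congr_ae (Eventually.of_forall fun w => ?_)
  simp only [Real.fourierInv_eq, Circle.smul_def, smul_eq_mul, ← integral_const_mul]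
  refine integral_congr_ae (Eventually.of_forall fun z => ?_)
  ring

end Plancherel

end RigidDPP

/-! ### Mass bound and lower bound for the structure factor -/

namespace RigidDPP

open scoped FourierTransform ComplexConjugate

section Spectral

variable {V : Type*} [NormedAddCommGroup V] [InnerProductSpace ℝ V] [FiniteDimensional ℝ V]
  [MeasurableSpace V] [BorelSpace V]

/-- A nonnegative function has mass at most one if its pairings with the autocorrelations of balls
are at most the volumes of these balls. -/
theorem lintegral_le_one_of_autocorrelation_le {H : V → ℝ≥0∞}
    (hyp : ∀ R : ℝ, ∫⁻ z, H z * ∫⁻ y, (Metric.closedBall (0 : V) R).indicator 1 (y + z) *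
      (Metric.closedBall (0 : V) R).indicator 1 y ≤ volume (Metric.closedBall (0 : V) R)) :
    ∫⁻ z, H z ≤ 1 := by
  set n := Module.finrank ℝ V
  have key : ∀ M T : ℝ, 0 ≤ M → 0 < T →
      -- For |z| ≤ M, the ball of radius T + M overlaps its translate in at least a ball of radius
      -- T. The ratio of the volumes tends to 1 as T → ∞.
      ∫⁻ z in Metric.closedBall (0 : V) M, H z ≤ ENNReal.ofReal ((1 + M / T) ^ n) := by
    intro M T hM hT
    have h1 : (∫⁻ z in Metric.closedBall (0 : V) M, H z) * volume (Metric.closedBall (0 : V) T)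
        ≤ volume (Metric.closedBall (0 : V) (T + M)) := by
      refine le_trans ?_ (hyp (T + M))
      have hfin : volume (Metric.closedBall (0 : V) T) ≠ ∞ := measure_closedBall_lt_top.ne
      rw [← lintegral_mul_const' _ _ hfin,
        ← lintegral_indicator Metric.isClosed_closedBall.measurableSet]
      refine lintegral_mono fun z => ?_
      by_cases hz : z ∈ Metric.closedBall (0 : V) M
      · rw [Set.indicator_of_mem hz]
        gcongr
        rw [← lintegral_indicator_one Metric.isClosed_closedBall.measurableSet]
        refine lintegral_mono fun y => ?_
        by_cases hy : y ∈ Metric.closedBall (0 : V) T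
        · have hy1 : y ∈ Metric.closedBall (0 : V) (T + M) :=
            Metric.closedBall_subset_closedBall (by linarith) hy
          have hy2 : y + z ∈ Metric.closedBall (0 : V) (T + M) := by
            simp only [mem_closedBall_zero_iff] at *
            exact (norm_add_le _ _).trans (by linarith)
          simp [Set.indicator_of_mem hy, Set.indicator_of_mem hy1, Set.indicator_of_mem hy2]
        · simp [Set.indicator_of_notMem hy]
      · simp [Set.indicator_of_notMem hz]
    rw [Measure.addHaar_closedBall _ _ hT.le, Measure.addHaar_closedBall _ _ (by positivity),
      ← mul_assoc] at h1
    have hb0 : volume (Metric.ball (0 : V) 1) ≠ 0 := (Metric.measure_ball_pos _ _ one_pos).ne'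
    have hb1 : volume (Metric.ball (0 : V) 1) ≠ ∞ := measure_ball_lt_top.ne
    rw [ENNReal.mul_le_mul_iff_left hb0 hb1] at h1
    have hTn : 0 < T ^ n := by positivity
    have : (1 + M / T) ^ n = (T + M) ^ n / T ^ n := by
      rw [← div_pow]; congr 1; field_simp
    rw [this, ENNReal.ofReal_div_of_pos hTn,
      ENNReal.le_div_iff_mul_le (Or.inl (by simpa using hTn)) (Or.inl ENNReal.ofReal_ne_top)]
    exact h1
  have key2 : ∀ M : ℝ, 0 ≤ M → ∫⁻ z in Metric.closedBall (0 : V) M, H z ≤ 1 := by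
    intro M hM
    have ht : Tendsto (fun T : ℝ => ENNReal.ofReal ((1 + M / T) ^ n)) atTop (𝓝 1) := by
      rw [← ENNReal.ofReal_one]
      refine ENNReal.tendsto_ofReal ?_
      have := ((tendsto_const_nhds (x := M)).div_atTop tendsto_id).const_add 1 |>.pow n
      simpa using this
    refine ge_of_tendsto ht ?_
    filter_upwards [eventually_gt_atTop 0] with T hT using key M T hM hT
  have hc : AECover (volume : Measure V) atTop fun M : ℕ => Metric.closedBall (0 : V) (M : ℝ) :=
    aecover_closedBall tendsto_natCast_atTop_atTop
  by_cases hH : AEMeasurable H volume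
  · exact le_of_tendsto' (hc.lintegral_tendsto_of_nat hH) fun M => key2 M (Nat.cast_nonneg _)
  -- H need not be measurable: a measurable minorant with the same integral replaces it.
  · obtain ⟨g, hgm, hgle, hgeq⟩ := exists_measurable_le_lintegral_eq volume H
    rw [hgeq]
    refine le_of_tendsto' (hc.lintegral_tendsto_of_nat hgm.aemeasurable) fun M => ?_
    exact (lintegral_mono hgle).trans (key2 M (Nat.cast_nonneg _))

/-- The structure factor `1 - ĥ`, with the normalisation `exp (-2πi⟨x, w⟩)` of the Fourier
transform. -/
noncomputable def structureFactor (h : V → ℝ) (w : V) : ℝ := 1 - (𝓕 (fun x => (h x : ℂ)) w).re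

theorem continuous_structureFactor {h : V → ℝ} (hh : Integrable h) :
    Continuous (structureFactor h) :=
  continuous_const.sub (Complex.continuous_re.comp (continuous_fourier hh.ofReal))

/-- Being a cosine transform, the real part is even in w whether or not h is even; the forward and
inverse transforms therefore have the same real part. -/
theorem re_fourier_ofReal {h : V → ℝ} (hh : Integrable h) (w : V) :
    (𝓕 (fun x => (h x : ℂ)) w).re = ∫ x, Real.cos (2 * Real.pi * inner ℝ x w) * h x := by
  rw [Real.fourier_eq']
  have hi : Integrable fun v => Complex.exp (↑(-2 * Real.pi * inner ℝ v w) * Complex.I) • (h v : ℂ) := by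
    have hho : Integrable fun v => (h v : ℂ) := hh.ofReal
    have hc : Continuous fun v : V => Complex.exp (↑(-2 * Real.pi * inner ℝ v w) * Complex.I) := by
      fun_prop
    refine hho.mono ?_ (Eventually.of_forall fun v => ?_)
    · exact hc.aestronglyMeasurable.smul hho.1
    · rw [norm_smul, Complex.norm_exp_ofReal_mul_I, one_mul]
  refine (integral_re hi).symm.trans (integral_congr_ae (Eventually.of_forall fun x => ?_))
  simp only [smul_eq_mul]
  change (_ : ℂ).re = _
  rw [Complex.re_mul_ofReal, Complex.exp_ofReal_mul_I_re]
  congr 1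
  rw [← Real.cos_neg]; congr 1; ring

theorem structureFactor_le_two {h : V → ℝ} (hh1 : ∀ x, 0 ≤ h x)
    (hm : ∫ x, h x ≤ 1) (w : V) : structureFactor h w ≤ 2 := by
  have h1 := norm_fourier_le (fun x => (h x : ℂ)) w
  have h2 : ∫ x, ‖(h x : ℂ)‖ = ∫ x, h x := by
    refine integral_congr_ae (Eventually.of_forall fun x => ?_)
    simp [abs_of_nonneg (hh1 x)]
  have h3 := (abs_le.1 (Complex.abs_re_le_norm (𝓕 (fun x => (h x : ℂ)) w))).1
  unfold structureFactor
  linarith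

/-- The structure factor of a density of mass at most one vanishes at most quadratically at the
origin, and is bounded below elsewhere. -/
theorem exists_le_structureFactor {h : V → ℝ} (hh : Integrable h) (hh0 : ∀ x, 0 ≤ h x)
    (hm : ∫ x, h x ≤ 1) :
    ∃ c > 0, ∀ w, c * min 1 (‖w‖ ^ 2) ≤ structureFactor h w := by
  set m := ∫ x, h x with hmdef
  have hm0 : 0 ≤ m := integral_nonneg hh0
  -- Up to the constant 1 - m ≥ 0, S is the structure factor; it is the integral of (1 - cos) h,
  -- hence nonnegative.
  set S : V → ℝ := fun w => m - (𝓕 (fun x => (h x : ℂ)) w).re with hS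
  have hSS : ∀ w, S w + (1 - m) = structureFactor h w := fun w => by
    simp only [hS, structureFactor]; ring
  have hci : ∀ w : V, Integrable fun x => Real.cos (2 * Real.pi * inner ℝ x w) * h x := fun w => by
    refine hh.mono ?_ (Eventually.of_forall fun v => ?_)
    · exact (Continuous.aestronglyMeasurable (by fun_prop)).mul hh.1
    · rw [norm_mul]
      exact mul_le_of_le_one_left (norm_nonneg _) (Real.abs_cos_le_one _)
  have hSint : ∀ w, S w = ∫ x, (1 - Real.cos (2 * Real.pi * inner ℝ x w)) * h x := fun w => by
    simp only [hS, re_fourier_ofReal hh, hmdef]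
    rw [← integral_sub hh (hci w)]
    refine integral_congr_ae (Eventually.of_forall fun x => ?_)
    ring
  -- From 1 - cos 2θ = 2(1 - cos θ)(1 + cos θ) ≤ 4(1 - cos θ). Iterated, this carries the lower
  -- bound at infinity, where S → m by Riemann–Lebesgue, back to the origin at quadratic cost, with
  -- no moment assumption on h.
  have hdouble : ∀ w, S ((2 : ℝ) • w) ≤ 4 * S w := fun w => by
    rw [hSint, hSint, ← integral_const_mul]
    have hi : ∀ w : V, Integrable fun x => (1 - Real.cos (2 * Real.pi * inner ℝ x w)) * h x :=
      fun w => (hh.sub (hci w)).congr (Eventually.of_forall fun x => by simp; ring)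
    refine integral_mono (hi _) ((hi _).const_mul 4) fun x => ?_
    simp only
    rw [inner_smul_right, ← mul_assoc 4]
    refine mul_le_mul_of_nonneg_right ?_ (hh0 x)
    have : 2 * Real.pi * (2 * inner ℝ x w) = 2 * (2 * Real.pi * inner ℝ x w) := by ring
    rw [this, Real.cos_two_mul]
    nlinarith [sq_nonneg (Real.cos (2 * Real.pi * inner ℝ x w) - 1)]
  -- When h = 0 almost everywhere, S vanishes and the bound comes from 1 - m = 1.
  rcases hm0.eq_or_lt with h0 | hmpos
  · refine ⟨1, one_pos, fun w => ?_⟩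
    have hae : h =ᵐ[volume] 0 := (integral_eq_zero_iff_of_nonneg hh0 hh).1 h0.symm
    have : S w = 0 := by
      rw [hSint]
      refine integral_eq_zero_of_ae ?_
      filter_upwards [hae] with x hx
      simp [hx]
    rw [← hSS, this, ← h0]
    simp
  have hRL : Tendsto (fun w => (𝓕 (fun x => (h x : ℂ)) w).re) (cocompact V) (𝓝 0) := by
    have := tendsto_integral_exp_inner_smul_cocompact (V := V) (fun x => (h x : ℂ))
    exact (Complex.continuous_re.tendsto 0).comp this
  have hev : ∀ᶠ w in cocompact V, (𝓕 (fun x => (h x : ℂ)) w).re < m / 2 :=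
    hRL.eventually_lt_const (by positivity)
  obtain ⟨R, hR⟩ : ∃ R, ∀ w : V, R < ‖w‖ → m / 2 ≤ S w := by
    rw [← Metric.cobounded_eq_cocompact, (Metric.hasBasis_cobounded_compl_closedBall (0 : V)).eventually_iff] at hev
    obtain ⟨R, -, hR⟩ := hev
    refine ⟨R, fun w hw => ?_⟩
    have := hR (x := w) (by simpa using hw)
    simp only [hS]; linarith
  set R' := max R 1
  have hR' : ∀ w : V, R' < ‖w‖ → m / 2 ≤ S w := fun w hw => hR w ((le_max_left _ _).trans_lt hw)
  have hR'1 : 1 ≤ R' := le_max_right _ _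
  -- Induction on the number of doublings needed to leave the ball of radius R'. The factor 4 in
  -- 4R'² keeps both w and 2w on the quadratic branch of the minimum while |w| ≤ R'.
  have claim : ∀ n : ℕ, ∀ w : V, R' < 2 ^ n * ‖w‖ →
      m / 2 * min 1 (‖w‖ ^ 2 / (4 * R' ^ 2)) ≤ S w := by
    intro n
    induction n with
    | zero =>
      intro w hw
      refine le_trans ?_ (hR' w (by simpa using hw))
      exact mul_le_of_le_one_right (by positivity) (min_le_left _ _)
    | succ n ih =>
      intro w hw
      by_cases hwR : R' < ‖w‖
      · refine le_trans ?_ (hR' w hwR)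
        exact mul_le_of_le_one_right (by positivity) (min_le_left _ _)
      · have h2 := ih ((2 : ℝ) • w) (by rw [norm_smul]; simp; rw [pow_succ] at hw; linarith)
        have h3 := hdouble w
        rw [norm_smul] at h2
        simp only [Real.norm_ofNat, mul_pow] at h2
        have hle : ‖w‖ ^ 2 / (4 * R' ^ 2) ≤ 1 / 4 := by
          rw [div_le_div_iff₀ (by positivity) (by norm_num)]
          have : ‖w‖ ^ 2 ≤ R' ^ 2 := by gcongr; exact not_lt.1 hwR
          linarith
        have e : 2 ^ 2 * ‖w‖ ^ 2 / (4 * R' ^ 2) = 4 * (‖w‖ ^ 2 / (4 * R' ^ 2)) := by ring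
        rw [e, min_eq_right (by linarith)] at h2
        rw [min_eq_right (by linarith)]
        linarith
  refine ⟨m / 2 / (4 * R' ^ 2), by positivity, fun w => ?_⟩
  have hfin : m / 2 * min 1 (‖w‖ ^ 2 / (4 * R' ^ 2)) ≤ S w := by
    rcases eq_or_ne w 0 with rfl | hw
    · rw [hSint]; simp
    · obtain ⟨n, hn⟩ := pow_unbounded_of_one_lt (R' / ‖w‖) (one_lt_two (α := ℝ))
      refine claim n w ?_
      rwa [div_lt_iff₀ (norm_pos_iff.2 hw)] at hn
  have hcmp : m / 2 / (4 * R' ^ 2) * min 1 (‖w‖ ^ 2) ≤ m / 2 * min 1 (‖w‖ ^ 2 / (4 * R' ^ 2)) := by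
    rw [div_mul_eq_mul_div, mul_div_assoc]
    gcongr
    refine le_min ?_ ?_
    · rw [div_le_one (by positivity)]
      nlinarith [min_le_left 1 (‖w‖ ^ 2)]
    · gcongr; exact min_le_right _ _
  linarith [hSS w]

end Spectral

end RigidDPP

/-! ### Measurability of linear statistics and sums over tuples of points -/

namespace RigidDPP

open scoped FourierTransform ComplexConjugate

variable {d : ℕ}

theorem tsum_eq_sum_of_support {α : Type*} [AddCommMonoid α] [TopologicalSpace α] [T2Space α]
    {f : E d → α} {C : Set (E d)} (hC : IsCompact C) (hf : ∀ x ∉ C, f x = 0)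
    (S : Configuration d) : ∑' x : S.1, f x = ∑ x ∈ (S.2 C hC).toFinset, f x := by
  rw [tsum_subtype S.1 f, tsum_eq_sum (s := (S.2 C hC).toFinset)]
  · refine Finset.sum_congr rfl fun x hx => Set.indicator_of_mem ?_ _
    exact ((S.2 C hC).mem_toFinset.1 hx).1
  · intro x hx
    by_cases hxS : x ∈ S.1
    · rw [Set.indicator_of_mem hxS]
      exact hf x fun hxC => hx ((S.2 C hC).mem_toFinset.2 ⟨hxS, hxC⟩)
    · exact Set.indicator_of_notMem hxS _

theorem measurable_count {C : Set (E d)} (hC : IsCompact C) :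
    Measurable (count C : Configuration d → ℕ) := by
  rw [measurable_iff_comap_le]
  exact le_iSup (fun C : {C : Set (E d) // IsCompact C} =>
    MeasurableSpace.comap (count C.1 : Configuration d → ℕ) ⊤) ⟨C, hC⟩

/-- The counting measure of the points of a configuration in a given set. -/
noncomputable def pointMeasure (C : Set (E d)) (S : Configuration d) : Measure (E d) :=
  Measure.count.restrict (S.1 ∩ C)

theorem pointMeasure_apply_of_isClosed {C F : Set (E d)} (hC : IsCompact C) (hF : IsClosed F)
    (S : Configuration d) : pointMeasure C S F = (count (C ∩ F) S : ℝ≥0∞) := by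
  have hfin := S.2 _ (hC.inter_right hF)
  have e : F ∩ (S.1 ∩ C) = S.1 ∩ (C ∩ F) := by
    ext x; simp only [Set.mem_inter_iff]; tauto
  rw [pointMeasure, Measure.restrict_apply hF.measurableSet, e, Measure.count_apply_finite _ hfin,
    count, Set.ncard_eq_toFinset_card _ hfin]

/-- Closed sets form a π-system generating the Borel σ-algebra, and on them the value is the count
of a compact set, measurable by definition. This makes linear statistics random variables. -/
theorem measurable_pointMeasure {C : Set (E d)} (hC : IsCompact C) :
    Measurable (pointMeasure C : Configuration d → Measure (E d)) := by
  have hm : ∀ F : Set (E d), IsClosed F → Measurable fun S => pointMeasure C S F := fun F hF => by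
    simp_rw [pointMeasure_apply_of_isClosed hC hF]
    exact (measurable_from_top (f := fun n : ℕ => (n : ℝ≥0∞))).comp
      (measurable_count (hC.inter_right hF))
  have : ∀ S : Configuration d, IsFiniteMeasure (pointMeasure C S) := fun S => ⟨by
    rw [pointMeasure_apply_of_isClosed hC isClosed_univ]; exact ENNReal.natCast_lt_top _⟩
  refine Measurable.measure_of_isPiSystem (S := {F | IsClosed F}) ?_ isPiSystem_isClosed hm
    (hm _ isClosed_univ)
  rw [← borel_eq_generateFrom_isClosed]
  exact BorelSpace.measurable_eq

theorem lintegral_pointMeasure {C : Set (E d)} (hC : IsCompact C) {f : E d → ℝ≥0∞}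
    (hf : ∀ x ∉ C, f x = 0) (S : Configuration d) :
    ∫⁻ x, f x ∂(pointMeasure C S) = ∑' x : S.1, f x := by
  have h := lintegral_finset (μ := Measure.count) (S.2 C hC).toFinset f
  rw [Set.Finite.coe_toFinset] at h
  rw [tsum_eq_sum_of_support hC hf, pointMeasure, h]
  simp

theorem measurable_tsum_of_support {C : Set (E d)} (hC : IsCompact C) {f : E d → ℝ≥0∞}
    (hfm : Measurable f) (hf : ∀ x ∉ C, f x = 0) :
    Measurable fun S : Configuration d => ∑' x : S.1, f x := by
  simp_rw [← lintegral_pointMeasure hC hf]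
  exact (Measure.measurable_lintegral hfm).comp (measurable_pointMeasure hC)

/-- Sums over injective `1`-tuples. -/
theorem tsum_tuple_one (S : Set (E d)) (f : E d → ℝ≥0∞) :
    ∑' x : {x : Fin 1 → E d // Function.Injective x ∧ ∀ i, x i ∈ S}, f (x.1 0) = ∑' x : S, f x := by
  let e : S ≃ {x : Fin 1 → E d // Function.Injective x ∧ ∀ i, x i ∈ S} :=
    { toFun := fun x => ⟨fun _ => x, Function.injective_of_subsingleton _, fun _ => x.2⟩
      invFun := fun x => ⟨x.1 0, x.2.2 0⟩
      left_inv := fun x => rfl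
      right_inv := fun x => Subtype.ext (funext fun i => by rw [Subsingleton.elim i 0]) }
  exact (e.tsum_eq fun x => f (x.1 0)).symm

/-- The square of a sum, decomposed into its diagonal and its sum over pairs of distinct points. -/
theorem tsum_mul_self_eq (S : Set (E d)) (f : E d → ℝ≥0∞) :
    (∑' x : S, f x) ^ 2 = (∑' x : S, f x ^ 2)
      + ∑' x : {x : Fin 2 → E d // Function.Injective x ∧ ∀ i, x i ∈ S}, f (x.1 0) * f (x.1 1) := by
  have h1 : (∑' x : S, f x) ^ 2 = ∑' p : S × S, f p.1 * f p.2 := by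
    rw [sq, ENNReal.tsum_prod', ← ENNReal.tsum_mul_right]
    refine tsum_congr fun x => ?_
    exact ENNReal.tsum_mul_left.symm
  rw [h1, ← ENNReal.summable.tsum_add_tsum_compl (s := {p : S × S | p.1 = p.2}) ENNReal.summable]
  congr 1
  · let e : S ≃ {p : S × S | p.1 = p.2} :=
      { toFun := fun x => ⟨(x, x), rfl⟩
        invFun := fun p => p.1.1
        left_inv := fun x => rfl
        right_inv := fun p => Subtype.ext (Prod.ext rfl p.2) }
    rw [← e.tsum_eq]
    exact tsum_congr fun x => (sq _).symm
  · let e : {x : Fin 2 → E d // Function.Injective x ∧ ∀ i, x i ∈ S} ≃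
        ({p : S × S | p.1 = p.2}ᶜ : Set (S × S)) :=
      { toFun := fun x => ⟨(⟨x.1 0, x.2.2 0⟩, ⟨x.1 1, x.2.2 1⟩), fun h => by
          have := x.2.1 (Subtype.ext_iff.1 h); simp at this⟩
        invFun := fun p => ⟨![p.1.1, p.1.2], by
          have hp : (p.1.1 : E d) ≠ p.1.2 := fun h => p.2 (Subtype.ext h)
          refine ⟨fun i j hij => ?_, fun i => ?_⟩
          · fin_cases i <;> fin_cases j <;> simp_all
          · fin_cases i
            · exact p.1.1.2
            · exact p.1.2.2⟩
        left_inv := fun x => Subtype.ext (funext fun i => by fin_cases i <;> rfl)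
        right_inv := fun p => rfl }
    rw [← e.tsum_eq]
    rfl

/-! ### First and second moments from the correlation functions -/

section Correlation

variable {K : E d → E d → ℂ}

/-- The one-point case of the stationarity of the correlations. -/
theorem ae_kernel_diag (hK0 : K 0 0 = 1) (hcorr : HasStationaryCorrelations K) :
    ∀ᵐ x : E d, K x x = 1 := by
  have h := hcorr 0
  have mp := (volume_preserving_funUnique (Fin 1) (E d)).symm
  have h2 := mp.quasiMeasurePreserving.ae h
  filter_upwards [h2] with x hx
  simpa [corrDet, hK0] using hx

theorem normSq_kernel_zero (hpos : IsHermitianPositive K) (z : E d) :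
    K z 0 * K 0 z = ((reducedKernel K z ^ 2 : ℝ) : ℂ) := by
  have h := (hpos 2 ![0, z]).isHermitian.apply 0 1
  simp only [Matrix.of_apply, Matrix.cons_val_zero, Matrix.cons_val_one] at h
  have h' : K z 0 = conj (K 0 z) := by rw [← h]; exact (star_star _).symm
  rw [h', mul_comm, Complex.mul_conj, Complex.normSq_eq_norm_sq, reducedKernel]

/-- Stationarity moves the pair to (z, 0) with z = x₀ - x₁. There the diagonal entries are 1 for
almost every pair, because null sets of z pull back to null sets under subtraction, and the
off-diagonal product is |K(0, z)|² by Hermitian symmetry. -/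
theorem ae_corrDet_two (hpos : IsHermitianPositive K) (hK0 : K 0 0 = 1)
    (hcorr : HasStationaryCorrelations K) :
    ∀ᵐ x : Fin 2 → E d, (corrDet K x).re = 1 - reducedKernel K (x 0 - x 1) ^ 2 := by
  have h1 : ∀ᵐ x : Fin 2 → E d, K (x 0 - x 1) (x 0 - x 1) = 1 := by
    have q : Measure.QuasiMeasurePreserving (fun p : E d × E d => p.1 - p.2)
        (volume.prod volume) volume := quasiMeasurePreserving_sub volume volume
    exact (q.comp (volume_preserving_finTwoArrow (E d)).quasiMeasurePreserving).ae
      (ae_kernel_diag hK0 hcorr)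
  filter_upwards [hcorr 1, h1] with x hx h1
  rw [hx]
  have : corrDet K (fun i => x i - x (Fin.last 1))
      = ((1 - reducedKernel K (x 0 - x 1) ^ 2 : ℝ) : ℂ) := by
    rw [corrDet, Matrix.det_fin_two]
    have hl : Fin.last 1 = 1 := rfl
    simp only [Matrix.of_apply, hl, sub_self, hK0, h1]
    have := normSq_kernel_zero hpos (x 0 - x 1)
    rw [this]; push_cast; ring
  rw [this, Complex.ofReal_re]

variable {Ω : Type*} [MeasurableSpace Ω] {μ : Measure Ω} {P : Ω → Configuration d}

theorem lintegral_tsum (hK0 : K 0 0 = 1) (hcorr : HasStationaryCorrelations K)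
    (hdet : IsDeterminantal μ P K) {f : E d → ℝ≥0∞} (hf : Measurable f) :
    ∫⁻ ω, ∑' x : (P ω).1, f x ∂μ = ∫⁻ x, f x := by
  have h := hdet 1 le_rfl (fun x => f (x 0)) (hf.comp (measurable_pi_apply 0))
  simp_rw [tsum_tuple_one] at h
  rw [h]
  have mp := (volume_preserving_funUnique (Fin 1) (E d))
  rw [← mp.lintegral_comp hf]
  refine lintegral_congr_ae ?_
  filter_upwards [mp.quasiMeasurePreserving.ae (ae_kernel_diag hK0 hcorr)] with x hx
  have hx' : K (x 0) (x 0) = 1 := hx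
  simp [corrDet, hx']

/-- The diagonal of the squared sum is computed from ρ₁ = 1 and the rest from ρ₂ = 1 - κ². The κ²
term stands on the left so that no subtraction occurs in `ℝ≥0∞`. -/
theorem lintegral_tsum_sq (hpos : IsHermitianPositive K) (hK : Measurable (Function.uncurry K))
    (hK0 : K 0 0 = 1) (hcorr : HasStationaryCorrelations K) (hP : Measurable P)
    (hdet : IsDeterminantal μ P K) {C : Set (E d)} (hC : IsCompact C) {f : E d → ℝ≥0∞}
    (hf : Measurable f) (hfC : ∀ x ∉ C, f x = 0) :
    ∫⁻ ω, (∑' x : (P ω).1, f x) ^ 2 ∂μ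
      + ∫⁻ z, ENNReal.ofReal (reducedKernel K z ^ 2) * ∫⁻ y, f (y + z) * f y
      = (∫⁻ x, f x ^ 2) + (∫⁻ x, f x) ^ 2 := by
  have hκm : Measurable fun z => ENNReal.ofReal (reducedKernel K z ^ 2) := by
    have : Measurable fun z => K 0 z := hK.comp (measurable_const.prodMk measurable_id)
    unfold reducedKernel
    fun_prop
  have h2 := hdet 2 one_le_two (fun x => f (x 0) * f (x 1)) (by fun_prop)
  simp_rw [tsum_mul_self_eq]
  have hm : Measurable fun ω => ∑' x : (P ω).1, f x ^ 2 :=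
    (measurable_tsum_of_support hC (hf.pow_const 2) fun x hx => by simp [hfC x hx]).comp hP
  rw [lintegral_add_left hm, lintegral_tsum hK0 hcorr hdet (hf.pow_const 2), h2,
    add_assoc]
  congr 1
  have mp := volume_preserving_finTwoArrow (E d)
  have e1 : ∫⁻ z, ENNReal.ofReal (reducedKernel K z ^ 2) * ∫⁻ y, f (y + z) * f y
      = ∫⁻ x : Fin 2 → E d,
        ENNReal.ofReal (reducedKernel K (x 0 - x 1) ^ 2) * (f (x 0) * f (x 1)) := by
    have hm : Measurable fun p : E d × E d =>
        ENNReal.ofReal (reducedKernel K (p.1 - p.2) ^ 2) * (f p.1 * f p.2) := by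
      exact (hκm.comp (measurable_fst.sub measurable_snd)).mul (by fun_prop)
    have e : ∫⁻ x : Fin 2 → E d,
        ENNReal.ofReal (reducedKernel K (x 0 - x 1) ^ 2) * (f (x 0) * f (x 1))
        = ∫⁻ p : E d × E d, ENNReal.ofReal (reducedKernel K (p.1 - p.2) ^ 2) * (f p.1 * f p.2)
          ∂(volume.prod volume) := mp.lintegral_comp hm
    rw [e, lintegral_prod_symm' _ hm]
    simp_rw [← lintegral_const_mul' _ _ ENNReal.ofReal_ne_top]
    rw [lintegral_lintegral_swap (by
      refine (Measurable.mul (hκm.comp measurable_fst) ?_).aemeasurable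
      fun_prop)]
    refine lintegral_congr fun y => ?_
    refine Eq.trans ?_ (lintegral_add_right_eq_self _ y)
    refine lintegral_congr fun z => ?_
    simp [add_comm z y]
  have e2 : (∫⁻ x, f x) ^ 2 = ∫⁻ x : Fin 2 → E d, f (x 0) * f (x 1) := by
    have e : ∫⁻ x : Fin 2 → E d, f (x 0) * f (x 1)
        = ∫⁻ p : E d × E d, f p.1 * f p.2 ∂(volume.prod volume) :=
      mp.lintegral_comp (f := fun p : E d × E d => f p.1 * f p.2) (by fun_prop)
    rw [e, lintegral_prod_mul hf.aemeasurable hf.aemeasurable, sq]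
  have hm2 : Measurable fun x : Fin 2 → E d =>
      ENNReal.ofReal (reducedKernel K (x 0 - x 1) ^ 2) * (f (x 0) * f (x 1)) := by
    exact (hκm.comp ((measurable_pi_apply 0).sub (measurable_pi_apply 1))).mul (by fun_prop)
  rw [e1, e2, ← lintegral_add_right _ hm2]
  refine lintegral_congr_ae ?_
  filter_upwards [ae_corrDet_two hpos hK0 hcorr] with x hx
  have h0 : 0 ≤ (corrDet K x).re := (Complex.le_def.1 (hpos 2 x).det_nonneg).1
  rw [← add_mul, hx, ← ENNReal.ofReal_add (hx ▸ h0) (sq_nonneg _)]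
  simp

/-- `∫ κ² ≤ 1`, as the variance of the number of points in a ball is nonnegative. -/
theorem lintegral_reducedKernel_sq_le [IsProbabilityMeasure μ] (hpos : IsHermitianPositive K)
    (hK : Measurable (Function.uncurry K))
    (hK0 : K 0 0 = 1) (hcorr : HasStationaryCorrelations K) (hP : Measurable P)
    (hdet : IsDeterminantal μ P K) :
    ∫⁻ z, ENNReal.ofReal (reducedKernel K z ^ 2) ≤ 1 := by
  refine lintegral_le_one_of_autocorrelation_le fun R => ?_
  set B := Metric.closedBall (0 : E d) R
  have hB : IsCompact B := isCompact_closedBall _ _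
  set f : E d → ℝ≥0∞ := B.indicator 1
  have hf : Measurable f := measurable_one.indicator hB.measurableSet
  have hfB : ∀ x ∉ B, f x = 0 := fun x hx => Set.indicator_of_notMem hx _
  have h := lintegral_tsum_sq hpos hK hK0 hcorr hP hdet hB hf hfB
  have h1 := lintegral_tsum hK0 hcorr hdet hf
  have e1 : ∫⁻ x, f x = volume B := lintegral_indicator_one hB.measurableSet
  have e2 : ∫⁻ x, f x ^ 2 = volume B := by
    rw [← e1]
    refine lintegral_congr fun x => ?_
    by_cases hx : x ∈ B <;> simp [f, hx]
  have hm : Measurable fun ω => ∑' x : (P ω).1, f x := (measurable_tsum_of_support hB hf hfB).comp hP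
  -- With N the number of points in B, (E N)² ≤ E N² by Cauchy–Schwarz, and E N is the volume of B.
  have jensen : (volume B) ^ 2 ≤ ∫⁻ ω, (∑' x : (P ω).1, f x) ^ 2 ∂μ := by
    rw [← e1, ← h1]
    have := ENNReal.lintegral_mul_le_Lp_mul_Lq μ (p := 2) (q := 2)
      (by constructor <;> norm_num) hm.aemeasurable (measurable_const (a := (1 : ℝ≥0∞))).aemeasurable
    simp only [Pi.mul_apply, mul_one, ENNReal.rpow_two] at this
    simp only [one_pow, lintegral_const, measure_univ, mul_one, ENNReal.one_rpow] at this
    calc _ ≤ ((∫⁻ ω, (∑' x : (P ω).1, f x) ^ 2 ∂μ) ^ (1 / 2 : ℝ)) ^ 2 := by gcongr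
      _ = _ := by rw [← ENNReal.rpow_natCast, ← ENNReal.rpow_mul]; norm_num
  rw [e1, e2] at h
  have hfin : volume B ≠ ∞ := hB.measure_lt_top.ne
  have h3 : (∫⁻ z, ENNReal.ofReal (reducedKernel K z ^ 2) * ∫⁻ y, f (y + z) * f y)
      + volume B ^ 2 ≤ volume B + volume B ^ 2 := by
    rw [← h, add_comm]; gcongr
  exact (ENNReal.add_le_add_iff_right (ENNReal.pow_ne_top hfin)).1 h3

end Correlation

end RigidDPP

/-! ### Test functions and the second-moment form -/

namespace RigidDPP

open scoped FourierTransform ComplexConjugate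

variable {d : ℕ}

/-- Bounded measurable functions with compact support. -/
structure IsTest {F : Type*} [NormedAddCommGroup F] [MeasurableSpace F] (f : E d → F) : Prop where
  measurable : Measurable f
  bounded : ∃ C : ℝ, ∀ x, ‖f x‖ ≤ C
  compact : HasCompactSupport f

namespace IsTest

theorem comp_norm_le {F G : Type*} [NormedAddCommGroup F] [MeasurableSpace F]
    [NormedAddCommGroup G] [MeasurableSpace G] {f : E d → F} (hf : IsTest f)
    {φ : F → G} (hφ : Measurable φ) (h : ∀ x, ‖φ x‖ ≤ ‖x‖) : IsTest fun x => φ (f x) := by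
  obtain ⟨C, hC⟩ := hf.bounded
  exact ⟨hφ.comp hf.measurable, ⟨C, fun x => (h _).trans (hC x)⟩,
    hf.compact.comp_left (g := φ) (by simpa using h 0)⟩

section General

variable {F : Type*} [NormedAddCommGroup F] [MeasurableSpace F] [BorelSpace F]
  [SecondCountableTopology F] {f g : E d → F}

theorem add (hf : IsTest f) (hg : IsTest g) : IsTest fun x => f x + g x := by
  obtain ⟨C, hC⟩ := hf.bounded
  obtain ⟨D, hD⟩ := hg.bounded
  exact ⟨hf.measurable.add hg.measurable,
    ⟨C + D, fun x => (norm_add_le _ _).trans (add_le_add (hC x) (hD x))⟩, hf.compact.add hg.compact⟩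

theorem sub (hf : IsTest f) (hg : IsTest g) : IsTest fun x => f x - g x := by
  obtain ⟨C, hC⟩ := hf.bounded
  obtain ⟨D, hD⟩ := hg.bounded
  exact ⟨hf.measurable.sub hg.measurable,
    ⟨C + D, fun x => (norm_sub_le _ _).trans (add_le_add (hC x) (hD x))⟩, hf.compact.sub hg.compact⟩

theorem memLp (hf : IsTest f) (p : ℝ≥0∞) : MemLp f p volume := by
  obtain ⟨C, hC⟩ := hf.bounded
  have h : MemLp ((tsupport f).indicator f) p volume := by
    rw [memLp_indicator_iff_restrict (isClosed_tsupport f).measurableSet]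
    have : IsFiniteMeasure ((volume : Measure (E d)).restrict (tsupport f)) :=
      isFiniteMeasure_restrict.2 hf.compact.isCompact.measure_lt_top.ne
    exact MemLp.of_bound hf.measurable.aestronglyMeasurable C (Eventually.of_forall hC)
  rwa [Set.indicator_eq_self.2 (subset_tsupport f)] at h

theorem integrable (hf : IsTest f) : Integrable f := memLp_one_iff_integrable.1 (hf.memLp 1)

end General

section Real

variable {f g : E d → ℝ}

theorem integrable_sq (hf : IsTest f) : Integrable fun x => f x ^ 2 := (hf.memLp 2).integrable_sq

theorem integrable_mul_translate (hf : IsTest f) (hg : IsTest g) (z : E d) :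
    Integrable fun y => f (y + z) * g y := by
  obtain ⟨C, hC⟩ := hf.bounded
  exact hg.integrable.bdd_mul (hf.measurable.comp (measurable_add_const z)).aestronglyMeasurable
    (Eventually.of_forall fun y => hC _)

theorem measurable_autocorrelation (hf : IsTest f) :
    StronglyMeasurable fun z => ∫ y, f (y + z) * f y := by
  refine StronglyMeasurable.integral_prod_right (f := fun z y => f (y + z) * f y) ?_
  have := hf.measurable
  exact Measurable.stronglyMeasurable (by fun_prop)

theorem integrable_mul_autocorrelation {h : E d → ℝ} (hh : Integrable h) (hf : IsTest f) :
    Integrable fun z => h z * ∫ y, f (y + z) * f y := by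
  obtain ⟨C, hC⟩ := hf.bounded
  refine hh.mul_bdd (c := C * ∫ y, ‖f y‖) hf.measurable_autocorrelation.aestronglyMeasurable
    (Eventually.of_forall fun z => ?_)
  refine (norm_integral_le_integral_norm _).trans ?_
  rw [← integral_const_mul]
  refine integral_mono_of_nonneg (Eventually.of_forall fun _ => norm_nonneg _)
    (hf.integrable.norm.const_mul C) (Eventually.of_forall fun y => ?_)
  simp only [norm_mul]
  exact mul_le_mul_of_nonneg_right (hC _) (norm_nonneg _)

end Real

end IsTest

/-- The second moment of the linear statistic of a real function `f`, for a process of unit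
intensity with pair correlation `1 - h(x - y)`. -/
noncomputable def secondMoment (h f : E d → ℝ) : ℝ :=
  (∫ x, f x ^ 2) + (∫ x, f x) ^ 2 - ∫ z, h z * ∫ y, f (y + z) * f y

/-- The parallelogram law of a quadratic form. It carries the moment formula from nonnegative
functions, the only ones the correlation identities cover, to real ones. -/
theorem secondMoment_sub {h a b : E d → ℝ} (hh : Integrable h) (ha : IsTest a) (hb : IsTest b) :
    secondMoment h (fun x => a x - b x)
      = 2 * secondMoment h a + 2 * secondMoment h b - secondMoment h (fun x => a x + b x) := by
  have hs := ha.sub hb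
  have hp := ha.add hb
  have e1 : (∫ x, (a x - b x) ^ 2) + ∫ x, (a x + b x) ^ 2 = 2 * (∫ x, a x ^ 2) + 2 * ∫ x, b x ^ 2 := by
    rw [← integral_const_mul, ← integral_const_mul, ← integral_add hs.integrable_sq hp.integrable_sq,
      ← integral_add (ha.integrable_sq.const_mul 2) (hb.integrable_sq.const_mul 2)]
    exact integral_congr_ae (Eventually.of_forall fun x => by ring)
  have e2 : ∫ x, (a x - b x) = (∫ x, a x) - ∫ x, b x := integral_sub ha.integrable hb.integrable
  have e3 : ∫ x, (a x + b x) = (∫ x, a x) + ∫ x, b x := integral_add ha.integrable hb.integrable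
  have e4 : ∀ z, (∫ y, (a (y + z) - b (y + z)) * (a y - b y))
      + (∫ y, (a (y + z) + b (y + z)) * (a y + b y))
      = 2 * (∫ y, a (y + z) * a y) + 2 * ∫ y, b (y + z) * b y := fun z => by
    rw [← integral_const_mul, ← integral_const_mul,
      ← integral_add (hs.integrable_mul_translate hs z) (hp.integrable_mul_translate hp z),
      ← integral_add ((ha.integrable_mul_translate ha z).const_mul 2)
        ((hb.integrable_mul_translate hb z).const_mul 2)]
    exact integral_congr_ae (Eventually.of_forall fun x => by ring)
  have e5 : (∫ z, h z * ∫ y, (a (y + z) - b (y + z)) * (a y - b y))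
      + (∫ z, h z * ∫ y, (a (y + z) + b (y + z)) * (a y + b y))
      = 2 * (∫ z, h z * ∫ y, a (y + z) * a y) + 2 * ∫ z, h z * ∫ y, b (y + z) * b y := by
    rw [← integral_const_mul, ← integral_const_mul,
      ← integral_add (hs.integrable_mul_autocorrelation hh) (hp.integrable_mul_autocorrelation hh),
      ← integral_add ((ha.integrable_mul_autocorrelation hh).const_mul 2)
        ((hb.integrable_mul_autocorrelation hh).const_mul 2)]
    refine integral_congr_ae (Eventually.of_forall fun z => ?_)
    linear_combination h z * e4 z
  unfold secondMoment
  rw [e2, e3]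
  linear_combination e1 - e5

/-- Plancherel turns ∫ |f|² into ∫ |𝓕 f|², and the pairing of h with the autocorrelation of f into ∫
|𝓕 f|² Re 𝓕 h. The mixed terms between real and imaginary parts drop out on taking the real part. -/
theorem secondMoment_re_add_im {h : E d → ℝ} (hh : Integrable h) {f : E d → ℂ} (hf : IsTest f) :
    secondMoment h (fun x => (f x).re) + secondMoment h (fun x => (f x).im)
      = ‖∫ x, f x‖ ^ 2 + ∫ w, ‖𝓕 f w‖ ^ 2 * structureFactor h w := by
  have hre : IsTest fun x => (f x).re := hf.comp_norm_le Complex.measurable_re Complex.abs_re_le_norm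
  have him : IsTest fun x => (f x).im := hf.comp_norm_le Complex.measurable_im Complex.abs_im_le_norm
  have hF : Integrable fun w => ‖𝓕 f w‖ ^ 2 :=
    (memLp_fourier hf.integrable (hf.memLp 2)).integrable_norm_pow (by norm_num)
  have e1 : ‖∫ x, f x‖ ^ 2 = (∫ x, (f x).re) ^ 2 + (∫ x, (f x).im) ^ 2 := by
    have h1 : ∫ x, (f x).re = (∫ x, f x).re := integral_re hf.integrable
    have h2 : ∫ x, (f x).im = (∫ x, f x).im := integral_im hf.integrable
    rw [h1, h2, ← Complex.normSq_eq_norm_sq, Complex.normSq_apply]; ring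
  have e2 : ∫ w, ‖𝓕 f w‖ ^ 2 = (∫ x, (f x).re ^ 2) + ∫ x, (f x).im ^ 2 := by
    have h1 := integral_fourier_mul_conj hf.integrable (hf.memLp 2) hf.integrable (hf.memLp 2)
    simp only [Complex.mul_conj, Complex.normSq_eq_norm_sq] at h1
    rw [integral_complex_ofReal, integral_complex_ofReal, Complex.ofReal_inj] at h1
    rw [h1, ← integral_add hre.integrable_sq him.integrable_sq]
    refine integral_congr_ae (Eventually.of_forall fun x => ?_)
    simp only
    rw [← Complex.normSq_eq_norm_sq, Complex.normSq_apply]; ring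
  have hfi : ∀ z, Integrable fun y => f (y + z) * conj (f y) := fun z => by
    obtain ⟨C, hC⟩ := hf.bounded
    have hc : Integrable fun y => conj (f y) :=
      (hf.comp_norm_le (φ := conj) (by fun_prop) (by simp)).integrable
    exact hc.bdd_mul (hf.measurable.comp (measurable_add_const z)).aestronglyMeasurable
      (Eventually.of_forall fun y => hC _)
  have hb : ∀ w, |(𝓕 (fun x => (h x : ℂ)) w).re| ≤ ∫ x, ‖(h x : ℂ)‖ := fun w =>
    (Complex.abs_re_le_norm _).trans (norm_fourier_le _ _)
  have hcont : Continuous fun w => (𝓕 (fun x => (h x : ℂ)) w).re :=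
    Complex.continuous_re.comp (continuous_fourier hh.ofReal)
  have hFh : Integrable fun w => ‖𝓕 f w‖ ^ 2 * (𝓕 (fun x => (h x : ℂ)) w).re :=
    hF.mul_bdd hcont.aestronglyMeasurable (Eventually.of_forall hb)
  have e3 : ∫ w, ‖𝓕 f w‖ ^ 2 * (𝓕 (fun x => (h x : ℂ)) w).re
      = (∫ z, h z * ∫ y, (f (y + z)).re * (f y).re) + ∫ z, h z * ∫ y, (f (y + z)).im * (f y).im := by
    have key := congrArg Complex.re
      (integral_mul_autocorrelation hf.integrable (hf.memLp 2) (hh.ofReal (𝕜 := ℂ)))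
    have hcR : ∀ z, (∫ y, f (y + z) * conj (f y)).re
        = (∫ y, (f (y + z)).re * (f y).re) + ∫ y, (f (y + z)).im * (f y).im := fun z => by
      rw [← integral_add (hre.integrable_mul_translate hre z) (him.integrable_mul_translate him z)]
      refine (integral_re (hfi z)).symm.trans (integral_congr_ae (Eventually.of_forall fun y => ?_))
      change (_ : ℂ).re = _
      simp
    have hmeas : StronglyMeasurable fun z => ∫ y, f (y + z) * conj (f y) := by
      refine StronglyMeasurable.integral_prod_right (f := fun z y => f (y + z) * conj (f y)) ?_
      have := hf.measurable
      exact Measurable.stronglyMeasurable (by fun_prop)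
    have hL : Integrable fun z => (h z : ℂ) * ∫ y, f (y + z) * conj (f y) := by
      obtain ⟨C, hC⟩ := hf.bounded
      refine (hh.ofReal (𝕜 := ℂ)).mul_bdd (c := C * ∫ y, ‖f y‖) hmeas.aestronglyMeasurable
        (Eventually.of_forall fun z => ?_)
      refine (norm_integral_le_integral_norm _).trans ?_
      rw [← integral_const_mul]
      refine integral_mono_of_nonneg (Eventually.of_forall fun _ => norm_nonneg _)
        (hf.integrable.norm.const_mul C) (Eventually.of_forall fun y => ?_)
      simp only [norm_mul, RCLike.norm_conj]
      exact mul_le_mul_of_nonneg_right (hC _) (norm_nonneg _)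
    have hR : Integrable fun w => ((‖𝓕 f w‖ ^ 2 : ℝ) : ℂ) * 𝓕⁻ (fun x => (h x : ℂ)) w := by
      have hcI : Continuous (𝓕⁻ fun x => (h x : ℂ)) := by
        rw [show 𝓕⁻ (fun x => (h x : ℂ)) = fun w => 𝓕 (fun x => (h x : ℂ)) (-w) from
          funext fun w => Real.fourierInv_eq_fourier_neg _ _]
        exact (continuous_fourier hh.ofReal).comp continuous_neg
      refine (hF.ofReal (𝕜 := ℂ)).mul_bdd (c := ∫ x, ‖(h x : ℂ)‖) hcI.aestronglyMeasurable
        (Eventually.of_forall fun w => ?_)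
      rw [Real.fourierInv_eq_fourier_neg]
      exact norm_fourier_le _ _
    rw [← integral_add (hre.integrable_mul_autocorrelation hh)
      (him.integrable_mul_autocorrelation hh)]
    have k1 := (integral_re hR).trans (key.symm.trans (integral_re hL).symm)
    have k2 : ∫ w, ‖𝓕 f w‖ ^ 2 * (𝓕 (fun x => (h x : ℂ)) w).re
        = ∫ w, RCLike.re (((‖𝓕 f w‖ ^ 2 : ℝ) : ℂ) * 𝓕⁻ (fun x => (h x : ℂ)) w) := by
      refine integral_congr_ae (Eventually.of_forall fun w => ?_)
      change ‖𝓕 f w‖ ^ 2 * (𝓕 (fun x => (h x : ℂ)) w).re = (_ : ℂ).re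
      rw [Complex.re_ofReal_mul, Real.fourierInv_eq_fourier_neg, re_fourier_ofReal hh,
        re_fourier_ofReal hh]
      simp
    rw [k2, k1]
    refine integral_congr_ae (Eventually.of_forall fun z => ?_)
    change (_ : ℂ).re = _
    rw [Complex.re_ofReal_mul, hcR]
    ring
  have e4 : ∫ w, ‖𝓕 f w‖ ^ 2 * structureFactor h w
      = (∫ w, ‖𝓕 f w‖ ^ 2) - ∫ w, ‖𝓕 f w‖ ^ 2 * (𝓕 (fun x => (h x : ℂ)) w).re := by
    rw [← integral_sub hF hFh]
    refine integral_congr_ae (Eventually.of_forall fun w => ?_)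
    simp only [structureFactor]; ring
  rw [e4, e3, e2, e1, secondMoment, secondMoment]
  ring

end RigidDPP

/-! ### Second moments of linear statistics -/

namespace RigidDPP

open scoped FourierTransform ComplexConjugate

variable {d : ℕ}

theorem IsTest.summable {F : Type*} [NormedAddCommGroup F] [MeasurableSpace F] {f : E d → F}
    (hf : IsTest f) (S : Configuration d) : Summable fun x : S.1 => f x := by
  refine summable_of_hasFiniteSupport ?_
  refine Set.Finite.of_injOn (t := S.1 ∩ tsupport f) (f := fun x : S.1 => (x : E d)) ?_
    Subtype.val_injective.injOn (S.2 _ hf.compact.isCompact)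
  exact fun x hx => ⟨x.2, subset_tsupport f hx⟩

variable {K : E d → E d → ℂ} {Ω : Type*} [MeasurableSpace Ω] {μ : Measure Ω}
  {P : Ω → Configuration d}

/-- The `ℝ≥0∞` identity transfers to the reals once the second moment is known to be finite, and
this follows from the identity itself, whose right-hand side is finite. -/
theorem integral_tsum_sq_of_nonneg (hpos : IsHermitianPositive K)
    (hK : Measurable (Function.uncurry K)) (hK0 : K 0 0 = 1) (hcorr : HasStationaryCorrelations K)
    (hP : Measurable P) (hdet : IsDeterminantal μ P K)
    (hκ : Integrable fun z => reducedKernel K z ^ 2) {f : E d → ℝ} (hf : IsTest f)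
    (h0 : ∀ x, 0 ≤ f x) :
    MemLp (fun ω => ∑' x : (P ω).1, f x) 2 μ ∧
      ∫ ω, (∑' x : (P ω).1, f x) ^ 2 ∂μ = secondMoment (fun z => reducedKernel K z ^ 2) f := by
  set F : E d → ℝ≥0∞ := fun x => ENNReal.ofReal (f x)
  have hFm : Measurable F := hf.measurable.ennreal_ofReal
  have hC := hf.compact.isCompact
  have hF0 : ∀ x ∉ tsupport f, F x = 0 := fun x hx => by
    simp [F, image_eq_zero_of_notMem_tsupport hx]
  have hs := lintegral_tsum_sq hpos hK hK0 hcorr hP hdet hC hFm hF0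
  have eI : ∀ S : Configuration d, ∑' x : S.1, F x = ENNReal.ofReal (∑' x : S.1, f x) := fun S =>
    (ENNReal.ofReal_tsum_of_nonneg (f := fun x : S.1 => f x) (fun x => h0 x) (hf.summable S)).symm
  have hI0 : ∀ S : Configuration d, 0 ≤ ∑' x : S.1, f x := fun S => tsum_nonneg fun x => h0 x
  have hmeas : Measurable fun ω => ∑' x : (P ω).1, f x := by
    have h1 : Measurable fun ω => (∑' x : (P ω).1, F x).toReal :=
      ((measurable_tsum_of_support hC hFm hF0).comp hP).ennreal_toReal
    simpa only [eI, ENNReal.toReal_ofReal (hI0 _)] using h1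
  have e1 : ∫⁻ x, F x = ENNReal.ofReal (∫ x, f x) :=
    (ofReal_integral_eq_lintegral_ofReal hf.integrable (Eventually.of_forall h0)).symm
  have e2 : ∫⁻ x, F x ^ 2 = ENNReal.ofReal (∫ x, f x ^ 2) := by
    rw [ofReal_integral_eq_lintegral_ofReal hf.integrable_sq
      (Eventually.of_forall fun _ => sq_nonneg _)]
    exact lintegral_congr fun x => (ENNReal.ofReal_pow (h0 x) 2).symm
  have e3 : ∀ z, ∫⁻ y, F (y + z) * F y = ENNReal.ofReal (∫ y, f (y + z) * f y) := fun z => by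
    rw [ofReal_integral_eq_lintegral_ofReal (hf.integrable_mul_translate hf z)
      (Eventually.of_forall fun y => mul_nonneg (h0 _) (h0 _))]
    exact lintegral_congr fun y => (ENNReal.ofReal_mul (h0 _)).symm
  have ha0 : ∀ z, 0 ≤ ∫ y, f (y + z) * f y := fun z =>
    integral_nonneg fun y => mul_nonneg (h0 _) (h0 _)
  have e4 : ∫⁻ z, ENNReal.ofReal (reducedKernel K z ^ 2) * ∫⁻ y, F (y + z) * F y
      = ENNReal.ofReal (∫ z, reducedKernel K z ^ 2 * ∫ y, f (y + z) * f y) := by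
    rw [ofReal_integral_eq_lintegral_ofReal (hf.integrable_mul_autocorrelation hκ)
      (Eventually.of_forall fun z => mul_nonneg (sq_nonneg _) (ha0 z))]
    refine lintegral_congr fun z => ?_
    rw [e3, ENNReal.ofReal_mul (sq_nonneg _)]
  have e5 : ∫⁻ ω, (∑' x : (P ω).1, F x) ^ 2 ∂μ
      = ∫⁻ ω, ENNReal.ofReal ((∑' x : (P ω).1, f x) ^ 2) ∂μ :=
    lintegral_congr fun ω => by rw [eI, ENNReal.ofReal_pow (hI0 _)]
  have hfint : (0 : ℝ) ≤ ∫ x, f x := integral_nonneg h0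
  have hB : 0 ≤ ∫ z, reducedKernel K z ^ 2 * ∫ y, f (y + z) * f y :=
    integral_nonneg fun z => mul_nonneg (sq_nonneg _) (ha0 z)
  have hA : 0 ≤ ∫ x, f x ^ 2 := integral_nonneg fun _ => sq_nonneg _
  rw [e1, e2, e4, e5, ← ENNReal.ofReal_pow hfint, ← ENNReal.ofReal_add hA (sq_nonneg _)] at hs
  have hfin : ∫⁻ ω, ENNReal.ofReal ((∑' x : (P ω).1, f x) ^ 2) ∂μ ≠ ∞ := by
    refine ne_top_of_le_ne_top (ENNReal.ofReal_ne_top (r := (∫ x, f x ^ 2) + (∫ x, f x) ^ 2)) ?_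
    rw [← hs]; exact le_self_add
  have hint : ∫ ω, (∑' x : (P ω).1, f x) ^ 2 ∂μ
      = (∫⁻ ω, ENNReal.ofReal ((∑' x : (P ω).1, f x) ^ 2) ∂μ).toReal :=
    integral_eq_lintegral_of_nonneg_ae (Eventually.of_forall fun _ => sq_nonneg _)
      (hmeas.pow_const 2).aestronglyMeasurable
  refine ⟨?_, ?_⟩
  · rw [memLp_two_iff_integrable_sq hmeas.aestronglyMeasurable]
    exact ⟨(hmeas.pow_const 2).aestronglyMeasurable,
      (hasFiniteIntegral_iff_ofReal (Eventually.of_forall fun _ => sq_nonneg _)).2 hfin.lt_top⟩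
  · have h1 := congrArg ENNReal.toReal hs
    rw [ENNReal.toReal_add hfin ENNReal.ofReal_ne_top, ← hint, ENNReal.toReal_ofReal hB,
      ENNReal.toReal_ofReal (by positivity)] at h1
    unfold secondMoment
    linarith

theorem integral_sub_sq {X Y : Ω → ℝ} (hX : MemLp X 2 μ) (hY : MemLp Y 2 μ) :
    ∫ ω, (X ω - Y ω) ^ 2 ∂μ
      = 2 * (∫ ω, X ω ^ 2 ∂μ) + 2 * (∫ ω, Y ω ^ 2 ∂μ) - ∫ ω, (X ω + Y ω) ^ 2 ∂μ := by
  have h1 : Integrable (fun ω => (X ω + Y ω) ^ 2) μ := (hX.add hY).integrable_sq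
  have h2 : Integrable (fun ω => 2 * X ω ^ 2) μ := hX.integrable_sq.const_mul 2
  have h3 : Integrable (fun ω => 2 * Y ω ^ 2) μ := hY.integrable_sq.const_mul 2
  rw [← integral_const_mul, ← integral_const_mul, ← integral_add h2 h3]
  refine Eq.trans ?_ (integral_sub (h2.add h3) h1)
  exact integral_congr_ae (Eventually.of_forall fun ω => by simp only; ring)

/-- Split f = a - b into positive and negative parts. Both sides obey the parallelogram law, and
they agree at the nonnegative functions a, b and a + b. -/
theorem integral_tsum_sq (hpos : IsHermitianPositive K)
    (hK : Measurable (Function.uncurry K)) (hK0 : K 0 0 = 1) (hcorr : HasStationaryCorrelations K)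
    (hP : Measurable P) (hdet : IsDeterminantal μ P K)
    (hκ : Integrable fun z => reducedKernel K z ^ 2) {f : E d → ℝ} (hf : IsTest f) :
    MemLp (fun ω => ∑' x : (P ω).1, f x) 2 μ ∧
      ∫ ω, (∑' x : (P ω).1, f x) ^ 2 ∂μ = secondMoment (fun z => reducedKernel K z ^ 2) f := by
  set a : E d → ℝ := fun x => max (f x) 0
  set b : E d → ℝ := fun x => max (-f x) 0
  have ha : IsTest a := hf.comp_norm_le (φ := fun x => max x 0) (by fun_prop) fun x => by
    rw [Real.norm_of_nonneg (le_max_right _ _)]; exact max_le (le_abs_self _) (abs_nonneg _)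
  have hb : IsTest b := hf.comp_norm_le (φ := fun x => max (-x) 0) (by fun_prop) fun x => by
    rw [Real.norm_of_nonneg (le_max_right _ _)]; exact max_le (neg_le_abs _) (abs_nonneg _)
  have hfab : f = fun x => a x - b x := funext fun x => (max_zero_sub_max_neg_zero_eq_self _).symm
  obtain ⟨ma, ia⟩ := integral_tsum_sq_of_nonneg hpos hK hK0 hcorr hP hdet hκ ha
    fun x => le_max_right _ _
  obtain ⟨mb, ib⟩ := integral_tsum_sq_of_nonneg hpos hK hK0 hcorr hP hdet hκ hb
    fun x => le_max_right _ _
  obtain ⟨-, ic⟩ := integral_tsum_sq_of_nonneg hpos hK hK0 hcorr hP hdet hκ (ha.add hb)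
    fun x => add_nonneg (le_max_right _ _) (le_max_right _ _)
  have es : ∀ S : Configuration d, ∑' x : S.1, f x = (∑' x : S.1, a x) - ∑' x : S.1, b x :=
    fun S => by
      rw [hfab]; exact (ha.summable S).tsum_sub (hb.summable S)
  have ep : ∀ S : Configuration d,
      ∑' x : S.1, (a x + b x) = (∑' x : S.1, a x) + ∑' x : S.1, b x :=
    fun S => (ha.summable S).tsum_add (hb.summable S)
  refine ⟨by simp_rw [es]; exact ma.sub mb, ?_⟩
  rw [hfab, secondMoment_sub hκ ha hb, ← ia, ← ib, ← ic, ← hfab]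
  simp_rw [es, ep]
  exact integral_sub_sq ma mb

/-- The second moment of a linear statistic, in the Fourier domain. -/
theorem integral_norm_linStat_sq (hpos : IsHermitianPositive K)
    (hK : Measurable (Function.uncurry K)) (hK0 : K 0 0 = 1) (hcorr : HasStationaryCorrelations K)
    (hP : Measurable P) (hdet : IsDeterminantal μ P K)
    (hκ : Integrable fun z => reducedKernel K z ^ 2) {f : E d → ℂ} (hf : IsTest f) :
    MemLp (fun ω => linStat f (P ω)) 2 μ ∧
      ∫ ω, ‖linStat f (P ω)‖ ^ 2 ∂μ
        = ‖∫ x, f x‖ ^ 2 + ∫ w, ‖𝓕 f w‖ ^ 2 * structureFactor (fun z => reducedKernel K z ^ 2) w := by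
  have hre : IsTest fun x => (f x).re := hf.comp_norm_le Complex.measurable_re Complex.abs_re_le_norm
  have him : IsTest fun x => (f x).im := hf.comp_norm_le Complex.measurable_im Complex.abs_im_le_norm
  obtain ⟨mr, ir⟩ := integral_tsum_sq hpos hK hK0 hcorr hP hdet hκ hre
  obtain ⟨mi, ii⟩ := integral_tsum_sq hpos hK hK0 hcorr hP hdet hκ him
  have er : ∀ S, (linStat f S).re = ∑' x : S.1, (f x).re := fun S =>
    Complex.reCLM.map_tsum (hf.summable S)
  have ei : ∀ S, (linStat f S).im = ∑' x : S.1, (f x).im := fun S =>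
    Complex.imCLM.map_tsum (hf.summable S)
  simp_rw [← er] at mr ir
  simp_rw [← ei] at mi ii
  refine ⟨?_, ?_⟩
  · have := mr.ofReal (K := ℂ) |>.add ((mi.ofReal (K := ℂ)).const_mul Complex.I)
    refine this.ae_eq (Eventually.of_forall fun ω => ?_)
    simp only [Pi.add_apply]
    rw [mul_comm]
    exact Complex.re_add_im _
  · rw [← secondMoment_re_add_im hκ hf, ← ir, ← ii,
      ← integral_add mr.integrable_sq mi.integrable_sq]
    refine integral_congr_ae (Eventually.of_forall fun ω => ?_)
    simp only
    rw [← Complex.normSq_eq_norm_sq, Complex.normSq_apply]; ring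

end RigidDPP

/-! ### Duality in the weighted Fourier norm -/

namespace RigidDPP

open scoped FourierTransform ComplexConjugate

variable {d : ℕ}

theorem IsTest.const_mul {f : E d → ℂ} (hf : IsTest f) (c : ℂ) : IsTest fun x => c * f x := by
  obtain ⟨C, hC⟩ := hf.bounded
  refine ⟨hf.measurable.const_mul c, ⟨‖c‖ * C, fun x => ?_⟩, hf.compact.mul_left⟩
  rw [norm_mul]
  exact mul_le_mul_of_nonneg_left (hC x) (norm_nonneg _)

theorem fourier_add_apply {f g : E d → ℂ} (hf : Integrable f) (hg : Integrable g) (w : E d) :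
    𝓕 (fun x => f x + g x) w = 𝓕 f w + 𝓕 g w :=
  congrFun (VectorFourier.fourierIntegral_add Real.continuous_fourierChar
    (by exact continuous_inner) hf hg) w

theorem fourier_const_mul_apply (f : E d → ℂ) (c : ℂ) (w : E d) :
    𝓕 (fun x => c * f x) w = c * 𝓕 f w :=
  congrFun (VectorFourier.fourierIntegral_const_smul Real.fourierChar volume (innerₗ (E d)) f c) w

theorem fourier_sub_apply {f g : E d → ℂ} (hf : Integrable f) (hg : Integrable g) (w : E d) :
    𝓕 (fun x => f x - g x) w = 𝓕 f w - 𝓕 g w := by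
  have h := fourier_add_apply hf (hg.const_mul (-1)) w
  rw [fourier_const_mul_apply] at h
  simpa [sub_eq_add_neg] using h

/-- The space of test functions vanishing on `A`. -/
def testSpace (A : Set (E d)) : Submodule ℂ (E d → ℂ) where
  carrier := {f | IsTest f ∧ ∀ x ∈ A, f x = 0}
  add_mem' {f g} hf hg := ⟨hf.1.add hg.1, fun x hx => by simp [hf.2 x hx, hg.2 x hx]⟩
  zero_mem' := ⟨⟨measurable_const, ⟨0, fun x => by simp⟩, HasCompactSupport.zero⟩, fun x _ => rfl⟩
  smul_mem' c f hf := ⟨hf.1.const_mul c, fun x hx => by simp [hf.2 x hx]⟩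

section Weighted

variable {σ : E d → ℝ}

theorem memLp_sqrt_mul (hσ : Continuous σ) (hσ2 : ∀ w, σ w ≤ 2) {f : E d → ℂ}
    (hf : MemLp f 2 volume) : MemLp (fun w => (√(σ w) : ℂ) * f w) 2 volume := by
  refine MemLp.of_le_mul (c := √2) hf ?_ (Eventually.of_forall fun w => ?_)
  · have hc : Continuous fun w => (√(σ w) : ℂ) := by fun_prop
    exact hc.aestronglyMeasurable.mul hf.1
  · rw [norm_mul, Complex.norm_real, Real.norm_of_nonneg (Real.sqrt_nonneg _)]
    gcongr
    exact hσ2 w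

theorem memLp_weightedFourier (hσ : Continuous σ) (hσ2 : ∀ w, σ w ≤ 2) {f : E d → ℂ}
    (hf : IsTest f) : MemLp (fun w => (√(σ w) : ℂ) * 𝓕 f w) 2 volume :=
  memLp_sqrt_mul hσ hσ2 (memLp_fourier hf.integrable (hf.memLp 2))

/-- The map `f ↦ √σ · f̂` from test functions vanishing on `A` to `L²`. -/
noncomputable def weightedFourier (hσ : Continuous σ) (hσ2 : ∀ w, σ w ≤ 2) (A : Set (E d)) :
    testSpace A →ₗ[ℂ] Lp ℂ 2 (volume : Measure (E d)) where
  toFun f := (memLp_weightedFourier hσ hσ2 f.2.1).toLp _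
  map_add' f g := by
    rw [← MemLp.toLp_add]
    congr 1
    funext w
    have : 𝓕 (((f + g : testSpace A) : E d → ℂ)) w = 𝓕 (f : E d → ℂ) w + 𝓕 (g : E d → ℂ) w :=
      fourier_add_apply f.2.1.integrable g.2.1.integrable w
    simp only [this, Pi.add_apply, mul_add]
  map_smul' c f := by
    rw [RingHom.id_apply, ← MemLp.toLp_const_smul]
    congr 1
    funext w
    have : 𝓕 (((c • f : testSpace A) : E d → ℂ)) w = c * 𝓕 (f : E d → ℂ) w :=
      fourier_const_mul_apply f c w
    simp only [this, Pi.smul_apply, smul_eq_mul]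
    ring

/-- Pairing with `ψ` after weighting is pairing with the inverse Fourier transform of `√σ ψ`. -/
theorem inner_weightedFourier (hσ : Continuous σ) (hσ2 : ∀ w, σ w ≤ 2)
    (ψ : Lp ℂ 2 (volume : Measure (E d))) {f : E d → ℂ} (hf : IsTest f) :
    inner ℂ ψ ((memLp_weightedFourier hσ hσ2 hf).toLp _)
      = ∫ x, f x * conj ((𝓕⁻ ((memLp_sqrt_mul hσ hσ2 (Lp.memLp ψ)).toLp _) :
          Lp ℂ 2 (volume : Measure (E d))) x) := by
  set q := (memLp_sqrt_mul hσ hσ2 (Lp.memLp ψ)).toLp _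
  have hq := (memLp_sqrt_mul hσ hσ2 (Lp.memLp ψ)).coeFn_toLp
  have h1 : inner ℂ ψ ((memLp_weightedFourier hσ hσ2 hf).toLp _)
      = inner ℂ q (𝓕 ((hf.memLp 2).toLp f)) := by
    rw [L2.inner_def, L2.inner_def]
    refine integral_congr_ae ?_
    filter_upwards [hq, (memLp_weightedFourier hσ hσ2 hf).coeFn_toLp,
      fourier_toLp_ae_eq hf.integrable (hf.memLp 2)] with w e1 e2 e3
    rw [e1, e2, e3]
    simp only [RCLike.inner_apply, map_mul, Complex.conj_ofReal]
    ring
  rw [h1]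
  have h2 : q = 𝓕 (𝓕⁻ q) := (FourierTransform.fourier_fourierInv_eq q).symm
  rw [h2, Lp.inner_fourier_eq, FourierTransform.fourierInv_fourier_eq, L2.inner_def]
  refine integral_congr_ae ?_
  filter_upwards [(hf.memLp 2).coeFn_toLp] with x hx
  rw [hx, RCLike.inner_apply]

/-- Near 0 one has |g| > δ by continuity, so δ² ≤ σ|ψ|² and 1/σ is dominated by the integrable
function |ψ|²/δ². -/
theorem exists_setLIntegral_inv_lt_top (hσ0 : ∀ w, 0 ≤ σ w) {ψ g : E d → ℂ}
    (hψ : MemLp ψ 2 volume) (hg : Continuous g) (hg0 : g 0 ≠ 0)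
    (h : g =ᵐ[volume] fun w => (√(σ w) : ℂ) * ψ w) :
    ∃ ε > 0, ∫⁻ w in Metric.ball (0 : E d) ε, (ENNReal.ofReal (σ w))⁻¹ < ∞ := by
  set δ := ‖g 0‖ / 2
  have hδ : 0 < δ := by have := norm_pos_iff.2 hg0; positivity
  have hev : ∀ᶠ w in 𝓝 (0 : E d), δ < ‖g w‖ :=
    hg.norm.continuousAt.eventually_const_lt (by simpa [δ] using norm_pos_iff.2 hg0)
  obtain ⟨ε, hε, hball⟩ := Metric.eventually_nhds_iff_ball.1 hev
  refine ⟨ε, hε, ?_⟩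
  have hle : ∫⁻ w in Metric.ball (0 : E d) ε, (ENNReal.ofReal (σ w))⁻¹
      ≤ ∫⁻ w in Metric.ball (0 : E d) ε, (ENNReal.ofReal (δ ^ 2))⁻¹ * ‖ψ w‖ₑ ^ 2 := by
    refine lintegral_mono_ae ?_
    filter_upwards [ae_restrict_of_ae h, ae_restrict_mem Metric.isOpen_ball.measurableSet]
      with w hw hwb
    have h1 := hball w hwb
    rw [hw, norm_mul, Complex.norm_real, Real.norm_of_nonneg (Real.sqrt_nonneg _)] at h1
    have h2 : δ ^ 2 ≤ σ w * ‖ψ w‖ ^ 2 := by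
      have := pow_le_pow_left₀ hδ.le h1.le 2
      rwa [mul_pow, Real.sq_sqrt (hσ0 w)] at this
    have hσpos : 0 < σ w := by
      by_contra hc
      have : σ w = 0 := le_antisymm (not_lt.1 hc) (hσ0 w)
      rw [this, zero_mul] at h2
      exact absurd h2 (not_le.2 (by positivity))
    have e : ‖ψ w‖ₑ ^ 2 = ENNReal.ofReal (‖ψ w‖ ^ 2) := by
      rw [ENNReal.ofReal_pow (norm_nonneg _), ofReal_norm]
    rw [e, ← ENNReal.ofReal_inv_of_pos hσpos, ← ENNReal.ofReal_inv_of_pos (by positivity),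
      ← ENNReal.ofReal_mul (by positivity)]
    refine ENNReal.ofReal_le_ofReal ?_
    rw [inv_mul_eq_div, inv_eq_one_div, div_le_div_iff₀ hσpos (by positivity)]
    linarith
  refine hle.trans_lt ((setLIntegral_le_lintegral _ _).trans_lt ?_)
  rw [lintegral_const_mul' _ _ (ENNReal.inv_ne_top.2 (by simpa using hδ.ne'))]
  refine ENNReal.mul_lt_top (ENNReal.inv_lt_top.2 (ENNReal.ofReal_pos.2 (by positivity))) ?_
  have := hψ.eLpNorm_lt_top
  rw [eLpNorm_lt_top_iff_lintegral_rpow_enorm_lt_top (by norm_num) (by norm_num)] at this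
  simpa using this

/-- If `1 / σ` is not integrable at the origin, then the indicator function of a compact set is
approximated, in the norm with density `σ` on the Fourier side, by test functions vanishing on this
set. -/
theorem exists_approx_indicator (hσ : Continuous σ) (hσ0 : ∀ w, 0 ≤ σ w) (hσ2 : ∀ w, σ w ≤ 2)
    {A : Set (E d)} (hA : IsCompact A)
    (hpole : ∀ ε > 0, ∫⁻ w in Metric.ball (0 : E d) ε, (ENNReal.ofReal (σ w))⁻¹ = ∞)
    {γ : E d → ℂ} (hγ : IsTest γ) (hγA : γ = A.indicator 1) {ε : ℝ} (hε : 0 < ε) :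
    ∃ f ∈ testSpace A, ∫ w, ‖𝓕 (fun x => f x - γ x) w‖ ^ 2 * σ w < ε := by
  set x₀ := (memLp_weightedFourier hσ hσ2 hγ).toLp _
  set N := LinearMap.range (weightedFourier hσ hσ2 A)
  by_cases hx : x₀ ∈ N.topologicalClosure
  · obtain ⟨y, hyN, hy⟩ := Metric.mem_closure_iff.1 hx (√ε) (Real.sqrt_pos.2 hε)
    obtain ⟨f, rfl⟩ := hyN
    refine ⟨f, f.2, ?_⟩
    have hm := memLp_weightedFourier hσ hσ2 (f.2.1.sub hγ)
    have e : weightedFourier hσ hσ2 A f - x₀ = hm.toLp _ := by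
      change (memLp_weightedFourier hσ hσ2 f.2.1).toLp _
        - (memLp_weightedFourier hσ hσ2 hγ).toLp _ = _
      rw [← MemLp.toLp_sub]
      congr 1
      funext w
      simp only [fourier_sub_apply f.2.1.integrable hγ.integrable, Pi.sub_apply, mul_sub]
    rw [dist_comm, dist_eq_norm, e] at hy
    have h2 := pow_lt_pow_left₀ hy (norm_nonneg _) two_ne_zero
    rw [Real.sq_sqrt hε.le] at h2
    refine lt_of_le_of_lt (le_of_eq ?_) h2
    have h3 : ‖hm.toLp _‖ ^ 2 = RCLike.re (inner ℂ (hm.toLp _) (hm.toLp _)) :=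
      (inner_self_eq_norm_sq (𝕜 := ℂ) _).symm
    rw [h3, L2.inner_def, ← integral_re (L2.integrable_inner _ _)]
    refine integral_congr_ae ?_
    filter_upwards [hm.coeFn_toLp] with w hw
    rw [hw, inner_self_eq_norm_sq, norm_mul, Complex.norm_real,
      Real.norm_of_nonneg (Real.sqrt_nonneg _), mul_pow, Real.sq_sqrt (hσ0 w)]
    ring
  -- Otherwise some ψ is orthogonal to all weighted transforms of test functions vanishing on A, but
  -- not to that of γ.
  · exfalso
    rw [← Submodule.orthogonal_orthogonal_eq_closure, Submodule.mem_orthogonal] at hx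
    push Not at hx
    obtain ⟨ψ, hψN, hψ⟩ := hx
    set q := (memLp_sqrt_mul hσ hσ2 (Lp.memLp ψ)).toLp _
    set G : Lp ℂ 2 (volume : Measure (E d)) := 𝓕⁻ q with hGdef
    have horth : ∀ f ∈ testSpace A, ∫ x, f x * conj (G x) = 0 := fun f hf => by
      rw [hGdef, ← inner_weightedFourier hσ hσ2 ψ hf.1]
      rw [Submodule.mem_orthogonal'] at hψN
      exact hψN _ ⟨⟨f, hf⟩, rfl⟩
    -- Orthogonality to smooth functions compactly supported off A makes G vanish there. Hence G
    -- lives on a compact set and is integrable, so its Fourier transform is continuous.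
    have hG0 : ∀ᵐ x, x ∈ Aᶜ → conj (G x) = 0 := by
      have hloc : LocallyIntegrable (fun x => conj (G x)) volume :=
        (MemLp.star (Lp.memLp G)).locallyIntegrable (by norm_num)
      refine hA.isClosed.isOpen_compl.ae_eq_zero_of_integral_contDiff_smul_eq_zero
        (hloc.locallyIntegrableOn _) fun g hg hgc hgs => ?_
      have hf : (fun x => (g x : ℂ)) ∈ testSpace A := by
        obtain ⟨C, hC⟩ := hgc.exists_bound_of_continuous hg.continuous
        refine ⟨⟨?_, ⟨C, fun x => by simpa using hC x⟩,
          hgc.comp_left (g := Complex.ofReal) rfl⟩, fun x hx => ?_⟩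
        · exact (Complex.continuous_ofReal.comp hg.continuous).measurable
        · have : x ∉ tsupport g := fun h => hgs h hx
          simp [image_eq_zero_of_notMem_tsupport this]
      simpa using horth _ hf
    have hGind : G =ᵐ[volume] A.indicator G := by
      filter_upwards [hG0] with x hx
      by_cases hxA : x ∈ A
      · rw [Set.indicator_of_mem hxA]
      · rw [Set.indicator_of_notMem hxA]
        simpa using hx hxA
    have hI2 : MemLp (A.indicator G) 2 volume := (Lp.memLp G).indicator hA.measurableSet
    have hI1 : Integrable (A.indicator G) := by
      rw [integrable_indicator_iff hA.measurableSet]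
      have : IsFiniteMeasure ((volume : Measure (E d)).restrict A) :=
        isFiniteMeasure_restrict.2 hA.measure_lt_top.ne
      exact ((Lp.memLp G).restrict A).integrable (by norm_num)
    have hGe : hI2.toLp _ = G := by
      refine Lp.ext (hI2.coeFn_toLp.trans hGind.symm)
    have hF : 𝓕 (A.indicator G) =ᵐ[volume] fun w => (√(σ w) : ℂ) * ψ w := by
      have h1 := fourier_toLp_ae_eq hI1 hI2
      rw [hGe, hGdef, FourierTransform.fourier_fourierInv_eq] at h1
      exact h1.symm.trans (memLp_sqrt_mul hσ hσ2 (Lp.memLp ψ)).coeFn_toLp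
    -- The value at 0 is ∫_A G, the complex conjugate of the pairing of ψ with the weighted
    -- transform of γ = 1_A.
    have hF0 : 𝓕 (A.indicator G) 0 ≠ 0 := by
      intro hzero
      have h1 : 𝓕 (A.indicator G) 0 = ∫ x, A.indicator G x := by
        rw [Real.fourier_eq]; simp
      refine hψ ?_
      rw [inner_weightedFourier hσ hσ2 ψ hγ]
      have h2 : ∫ x, γ x * conj (G x) = conj (∫ x, A.indicator G x) := by
        rw [← integral_conj]
        refine integral_congr_ae (Eventually.of_forall fun x => ?_)
        by_cases hxA : x ∈ A <;> simp [hγA, hxA]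
      exact h2.trans (by rw [← h1, hzero, map_zero])
    obtain ⟨ε', hε', hlt⟩ := exists_setLIntegral_inv_lt_top hσ0 (Lp.memLp ψ)
      (continuous_fourier hI1) hF0 hF
    exact hlt.ne (hpole ε' hε')

/-- Cauchy–Schwarz inequality with weights `σ` and `1 / σ` on the Fourier side. -/
theorem enorm_integral_mul_conj_sq_le (hσ : Continuous σ) (hσpos : ∀ᵐ w, 0 < σ w)
    {f G : E d → ℂ} (hf : IsTest f) (hG : IsTest G) :
    ‖∫ x, f x * conj (G x)‖ₑ ^ 2 ≤ (∫⁻ w, ‖𝓕 f w‖ₑ ^ 2 * ENNReal.ofReal (σ w))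
      * ∫⁻ w, ‖𝓕 G w‖ₑ ^ 2 / ENNReal.ofReal (σ w) := by
  rw [← integral_fourier_mul_conj hf.integrable (hf.memLp 2) hG.integrable (hG.memLp 2)]
  have hcf := continuous_fourier hf.integrable
  have hcG := continuous_fourier hG.integrable
  have hm1 : AEMeasurable (fun w => ‖𝓕 f w‖ₑ * ENNReal.ofReal √(σ w)) volume := by
    have : Measurable fun w => ‖𝓕 f w‖ₑ := hcf.measurable.enorm
    exact (this.mul (by fun_prop)).aemeasurable
  have hm2 : AEMeasurable (fun w => ‖𝓕 G w‖ₑ / ENNReal.ofReal √(σ w)) volume := by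
    have : Measurable fun w => ‖𝓕 G w‖ₑ := hcG.measurable.enorm
    exact (this.div (by fun_prop)).aemeasurable
  have h1 : ‖∫ w, 𝓕 f w * conj (𝓕 G w)‖ₑ
      ≤ ∫⁻ w, (‖𝓕 f w‖ₑ * ENNReal.ofReal √(σ w)) * (‖𝓕 G w‖ₑ / ENNReal.ofReal √(σ w)) := by
    refine (enorm_integral_le_lintegral_enorm _).trans (lintegral_mono_ae ?_)
    filter_upwards [hσpos] with w hw
    have hs : ENNReal.ofReal √(σ w) ≠ 0 := by simpa using Real.sqrt_pos.2 hw
    rw [enorm_mul, mul_assoc, ENNReal.mul_div_cancel hs ENNReal.ofReal_ne_top]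
    simp
  have h2 := ENNReal.lintegral_mul_le_Lp_mul_Lq volume (p := 2) (q := 2)
    (by constructor <;> norm_num) hm1 hm2
  simp only [Pi.mul_apply, ENNReal.rpow_two] at h2
  have h3 := pow_le_pow_left' (h1.trans h2) 2
  have hsq : ∀ a : ℝ≥0∞, (a ^ (1 / 2 : ℝ)) ^ 2 = a := fun a => by
    rw [← ENNReal.rpow_natCast, ← ENNReal.rpow_mul]; norm_num
  rw [mul_pow, hsq, hsq] at h3
  refine h3.trans (le_of_eq ?_)
  have hofs : ∀ᵐ w, ENNReal.ofReal √(σ w) ^ 2 = ENNReal.ofReal (σ w) := by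
    filter_upwards [hσpos] with w hw
    rw [← ENNReal.ofReal_pow (Real.sqrt_nonneg _), Real.sq_sqrt hw.le]
  congr 1
  · refine lintegral_congr_ae ?_
    filter_upwards [hofs] with w hw
    rw [mul_pow, hw]
  · refine lintegral_congr_ae ?_
    filter_upwards [hofs] with w hw
    rw [div_eq_mul_inv, mul_pow, ← ENNReal.inv_pow, hw, ← div_eq_mul_inv]

end Weighted

end RigidDPP

/-! ### Poles at the origin -/

namespace RigidDPP

open scoped FourierTransform ComplexConjugate

variable {d : ℕ}

section Poles

variable {s : E d → ℝ}

theorem enorm_sq_eq_ofReal (z : ℂ) : ‖z‖ₑ ^ 2 = ENNReal.ofReal (‖z‖ ^ 2) := by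
  rw [ENNReal.ofReal_pow (norm_nonneg _), ofReal_norm]

theorem enorm_sq_div_le {c t : ℝ} (hc : 0 ≤ c) {z : ℂ} (h : ‖z‖ ^ 2 ≤ c * t) :
    ‖z‖ₑ ^ 2 / ENNReal.ofReal t ≤ ENNReal.ofReal c := by
  refine ENNReal.div_le_of_le_mul ?_
  rw [← ENNReal.ofReal_mul hc, enorm_sq_eq_ofReal]
  exact ENNReal.ofReal_le_ofReal h

/-- A first-order zero of F offsets the at most quadratic vanishing of s: the quotient is at most
C²/c. -/
theorem setLIntegral_ball_one_lt_top {c C : ℝ} (hc : 0 < c)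
    (hs : ∀ u, c * min 1 (‖u‖ ^ 2) ≤ s u) {F : E d → ℂ} (hF : ∀ u, ‖u‖ ≤ 1 → ‖F u‖ ≤ C * ‖u‖) :
    ∫⁻ u in Metric.ball (0 : E d) 1, ‖F u‖ₑ ^ 2 / ENNReal.ofReal (s u) < ∞ := by
  refine lt_of_le_of_lt (setLIntegral_mono' (g := fun _ => ENNReal.ofReal (C ^ 2 / c))
    Metric.isOpen_ball.measurableSet fun u hu => ?_) ?_
  · have hu1 : ‖u‖ ≤ 1 := (mem_ball_zero_iff.1 hu).le
    refine enorm_sq_div_le (by positivity) ?_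
    have h1 := hs u
    rw [min_eq_right (pow_le_one₀ (norm_nonneg _) hu1)] at h1
    calc ‖F u‖ ^ 2 ≤ (C * ‖u‖) ^ 2 := by gcongr; exact hF u hu1
      _ = C ^ 2 / c * (c * ‖u‖ ^ 2) := by field_simp
      _ ≤ _ := by gcongr
  · rw [setLIntegral_const]
    exact ENNReal.mul_lt_top ENNReal.ofReal_lt_top measure_ball_lt_top

theorem polyEval_monomial (k : Fin d →₀ ℕ) (t : E d) :
    polyEval (MvPolynomial.monomial k 1) t = ∏ i, ((t i : ℝ) : ℂ) ^ k i := by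
  rw [polyEval, MvPolynomial.eval_monomial, one_mul, Finsupp.prod_fintype _ _ (by simp)]

theorem continuous_polyEval (Q : MvPolynomial (Fin d) ℂ) : Continuous (polyEval Q) := by
  have : Continuous fun t : E d => fun i => ((t i : ℝ) : ℂ) := by fun_prop
  exact (MvPolynomial.continuous_eval Q).comp this

theorem polyEval_zero (Q : MvPolynomial (Fin d) ℂ) : polyEval Q 0 = Q.coeff 0 := by
  have : (fun i => (((0 : E d) i : ℝ) : ℂ)) = 0 := by ext; simp
  rw [polyEval, this, MvPolynomial.eval_zero, MvPolynomial.constantCoeff_eq]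

/-- A density vanishing at most quadratically only has poles of order zero. -/
theorem HasPole.eq_zero {c : ℝ} (hc : 0 < c) (hs : ∀ u, c * min 1 (‖u‖ ^ 2) ≤ s u)
    {k : Fin d →₀ ℕ} (h : HasPole s k) : k = 0 := by
  by_contra hk
  obtain ⟨j, hj⟩ := Finsupp.ne_iff.1 hk
  -- If k_j ≠ 0, then |u^k| ≤ |u_j| ≤ |u| on the unit ball, so u^k is an admissible polynomial with
  -- coefficient 1 at k.
  have := h (MvPolynomial.monomial k 1) ⟨1, one_pos,
    setLIntegral_ball_one_lt_top (C := 1) hc hs fun u hu => ?_⟩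
  · simp at this
  · have hi : ∀ i, ‖((u i : ℝ) : ℂ)‖ ≤ ‖u‖ := fun i => by
      rw [Complex.norm_real]; exact PiLp.norm_apply_le u i
    rw [polyEval_monomial, norm_prod, ← Finset.mul_prod_erase _ _ (Finset.mem_univ j), one_mul]
    refine (mul_le_of_le_one_right (norm_nonneg _) (Finset.prod_le_one (fun i _ => norm_nonneg _)
      fun i _ => ?_)).trans ?_
    · rw [norm_pow]; exact pow_le_one₀ (norm_nonneg _) ((hi i).trans hu)
    · rw [norm_pow]
      exact (pow_le_of_le_one (norm_nonneg _) ((hi j).trans hu) hj).trans (hi j)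

theorem HasPole.setLIntegral_eq_top (h : HasPole s 0) {ε : ℝ} (hε : 0 < ε) :
    ∫⁻ u in Metric.ball (0 : E d) ε, (ENNReal.ofReal (s u))⁻¹ = ∞ := by
  by_contra hfin
  have h1 := h 1 ⟨ε, hε, by
    refine lt_of_le_of_lt (le_of_eq ?_) (lt_top_iff_ne_top.2 hfin)
    refine lintegral_congr fun u => ?_
    simp [polyEval]⟩
  simp at h1

/-- A polynomial witnessing the failure has Q(0) ≠ 0, so |Q| is bounded below near 0 and can be
divided out. -/
theorem exists_setLIntegral_lt_top_of_not_hasPole (h : ¬ HasPole s 0) :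
    ∃ ε > 0, ∫⁻ u in Metric.ball (0 : E d) ε, (ENNReal.ofReal (s u))⁻¹ < ∞ := by
  unfold HasPole at h
  push Not at h
  obtain ⟨Q, ⟨ε₁, hε₁, hfin⟩, hQ⟩ := h
  set δ := ‖Q.coeff 0‖ / 2
  have hpos : 0 < ‖Q.coeff 0‖ := norm_pos_iff.2 hQ
  have hδ : 0 < δ := by positivity
  have hev : ∀ᶠ u in 𝓝 (0 : E d), δ < ‖polyEval Q u‖ :=
    (continuous_polyEval Q).norm.continuousAt.eventually_const_lt
      (by beta_reduce; rw [polyEval_zero]; exact half_lt_self hpos)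
  obtain ⟨ε₂, hε₂, hball⟩ := Metric.eventually_nhds_iff_ball.1 hev
  refine ⟨min ε₁ ε₂, lt_min hε₁ hε₂, ?_⟩
  have hle : ∫⁻ u in Metric.ball (0 : E d) (min ε₁ ε₂), (ENNReal.ofReal (s u))⁻¹
      ≤ ∫⁻ u in Metric.ball (0 : E d) (min ε₁ ε₂),
        (ENNReal.ofReal (δ ^ 2))⁻¹ * (‖polyEval Q u‖ₑ ^ 2 / ENNReal.ofReal (s u)) := by
    refine setLIntegral_mono' Metric.isOpen_ball.measurableSet fun u hu => ?_
    have h1 := hball u (Metric.ball_subset_ball (min_le_right _ _) hu)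
    have h2 : ENNReal.ofReal (δ ^ 2) ≤ ‖polyEval Q u‖ₑ ^ 2 := by
      rw [enorm_sq_eq_ofReal]; exact ENNReal.ofReal_le_ofReal (by gcongr)
    rw [div_eq_mul_inv, ← mul_assoc]
    refine le_mul_of_one_le_left (zero_le) ?_
    rw [← ENNReal.inv_mul_cancel (a := ENNReal.ofReal (δ ^ 2))
      (ENNReal.ofReal_pos.2 (by positivity)).ne' ENNReal.ofReal_ne_top]
    gcongr
  refine hle.trans_lt ?_
  rw [lintegral_const_mul' _ _ (ENNReal.inv_ne_top.2 (ENNReal.ofReal_pos.2 (by positivity)).ne')]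
  exact ENNReal.mul_lt_top (ENNReal.inv_lt_top.2 (ENNReal.ofReal_pos.2 (by positivity)))
    ((lintegral_mono_set (Metric.ball_subset_ball (min_le_left _ _))).trans_lt hfin)

/-- Integrals over balls around the origin under scaling. -/
theorem setLIntegral_ball_smul {F : E d → ℝ≥0∞} (hF : Measurable F) {r : ℝ} (hr : 0 < r) (ε : ℝ) :
    ∫⁻ u in Metric.ball (0 : E d) ε, F (r • u)
      = ENNReal.ofReal |(r ^ Module.finrank ℝ (E d))⁻¹| *
        ∫⁻ w in Metric.ball (0 : E d) (r * ε), F w := by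
  rw [← lintegral_indicator Metric.isOpen_ball.measurableSet,
    ← lintegral_indicator Metric.isOpen_ball.measurableSet, ← smul_eq_mul, ← lintegral_smul_measure,
    ← Measure.map_addHaar_smul _ hr.ne',
    lintegral_map (hF.indicator Metric.isOpen_ball.measurableSet) (by fun_prop)]
  refine lintegral_congr fun u => ?_
  have : r • u ∈ Metric.ball (0 : E d) (r * ε) ↔ u ∈ Metric.ball (0 : E d) ε := by
    simp only [mem_ball_zero_iff, norm_smul, Real.norm_of_nonneg hr.le]
    exact mul_lt_mul_iff_right₀ hr
  by_cases hu : u ∈ Metric.ball (0 : E d) ε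
  · rw [Set.indicator_of_mem hu, Set.indicator_of_mem (this.2 hu)]
  · rw [Set.indicator_of_notMem hu, Set.indicator_of_notMem (mt this.1 hu)]

/-- The two Fourier normalisations differ by a dilation by 2π, which does not affect integrability
at the origin (`setLIntegral_ball_smul`). -/
theorem spectralDensity_eq (K : E d → E d → ℂ) (u : E d) :
    spectralDensity K u = structureFactor (fun z => reducedKernel K z ^ 2) ((2 * Real.pi)⁻¹ • u) := by
  unfold spectralDensity structureFactor
  congr 2
  rw [fourierTransform, Real.fourier_eq']
  refine integral_congr_ae (Eventually.of_forall fun x => ?_)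
  simp only [smul_eq_mul]
  congr 2
  rw [inner_smul_right, real_inner_comm u x]
  have : -2 * Real.pi * ((2 * Real.pi)⁻¹ * inner ℝ u x) = - inner ℝ u x := by
    field_simp
  rw [this]
  push_cast; ring

end Poles

/-! ### Polynomials on sets with non-empty interior -/

section Polynomials

/-- A non-empty open set contains a cube, and a complex polynomial vanishing on a product of
infinite sets is zero. -/
theorem eq_zero_of_polyEval_eq_zero {Q : MvPolynomial (Fin d) ℂ} {U : Set (E d)} (hU : IsOpen U)
    (hne : U.Nonempty) (h : ∀ t ∈ U, polyEval Q t = 0) : Q = 0 := by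
  obtain ⟨x, hx⟩ := hne
  have hU' : IsOpen ((WithLp.toLp 2 : (Fin d → ℝ) → E d) ⁻¹' U) :=
    hU.preimage (PiLp.continuous_toLp 2 _)
  obtain ⟨ε, hε, hball⟩ := Metric.isOpen_iff.1 hU' (fun i => x i) (by exact hx)
  refine MvPolynomial.funext_set (fun i => Complex.ofReal '' Metric.ball (x i) ε) (fun i => ?_)
    fun y hy => ?_
  · refine Set.Infinite.image Complex.ofReal_injective.injOn ?_
    rw [Real.ball_eq_Ioo]
    exact Set.Ioo_infinite (by linarith)
  · choose t ht hty using fun i => hy i (Set.mem_univ i)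
    have hmem : t ∈ Metric.ball (fun i => x i) ε := by
      rw [ball_pi _ hε]; exact fun i _ => ht i
    have := h _ (hball hmem)
    have hy' : y = fun i => ((t i : ℝ) : ℂ) := funext fun i => (hty i).symm
    rw [map_zero, ← this, polyEval, hy']

theorem isTest_indicator_polyEval {A : Set (E d)} (hA : IsCompact A) (Q : MvPolynomial (Fin d) ℂ) :
    IsTest (A.indicator (polyEval Q)) := by
  obtain ⟨C, hC⟩ := hA.exists_bound_of_continuousOn (continuous_polyEval Q).continuousOn
  refine ⟨(continuous_polyEval Q).measurable.indicator hA.measurableSet, ⟨max C 0, fun x => ?_⟩,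
    HasCompactSupport.intro hA fun x hx => Set.indicator_of_notMem hx _⟩
  by_cases hx : x ∈ A
  · rw [Set.indicator_of_mem hx]; exact (hC x hx).trans (le_max_left _ _)
  · rw [Set.indicator_of_notMem hx, norm_zero]; exact le_max_right _ _

theorem eq_zero_of_integral_mul_conj_eq_zero {A : Set (E d)} (hA : IsCompact A)
    (hAint : (interior A).Nonempty) {Q : MvPolynomial (Fin d) ℂ}
    (h : ∫ x, A.indicator (polyEval Q) x * conj (A.indicator (polyEval Q) x) = 0) : Q = 0 := by
  have hT := isTest_indicator_polyEval hA Q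
  simp only [Complex.mul_conj, Complex.normSq_eq_norm_sq] at h
  rw [integral_complex_ofReal, Complex.ofReal_eq_zero, integral_eq_zero_iff_of_nonneg
    (fun _ => sq_nonneg _) ((hT.memLp 2).integrable_norm_pow (by norm_num))] at h
  have h1 : polyEval Q =ᵐ[volume.restrict (interior A)] fun _ => 0 := by
    filter_upwards [ae_restrict_of_ae h, ae_restrict_mem isOpen_interior.measurableSet] with x hx hxi
    rw [Set.indicator_of_mem (interior_subset hxi)] at hx
    simpa using hx
  exact eq_zero_of_polyEval_eq_zero isOpen_interior hAint
    (Measure.eqOn_open_of_ae_eq h1 isOpen_interior (continuous_polyEval Q).continuousOn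
      continuousOn_const)

end Polynomials

end RigidDPP

/-! ### Integrability against 1/σ and correction of the mean -/

namespace RigidDPP

open scoped FourierTransform ComplexConjugate

variable {d : ℕ}

section FourierWeight

variable {σ : E d → ℝ} {c : ℝ}

/-- Away from the origin σ is bounded below and 𝓕 G is square integrable, so only the behaviour at 0
matters. -/
theorem lintegral_fourier_div_lt_top (hc : 0 < c) (hσ : ∀ w, c * min 1 (‖w‖ ^ 2) ≤ σ w)
    {G : E d → ℂ} (hG : IsTest G) {ε : ℝ} (hε : 0 < ε)
    (h : ∫⁻ w in Metric.ball (0 : E d) ε, ‖𝓕 G w‖ₑ ^ 2 / ENNReal.ofReal (σ w) < ∞) :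
    ∫⁻ w, ‖𝓕 G w‖ₑ ^ 2 / ENNReal.ofReal (σ w) < ∞ := by
  have hB : MeasurableSet (Metric.ball (0 : E d) ε) := Metric.isOpen_ball.measurableSet
  rw [← lintegral_add_compl _ hB]
  refine ENNReal.add_lt_top.2 ⟨h, ?_⟩
  set m := c * min 1 (ε ^ 2)
  have hm : 0 < m := by positivity
  have hle : ∫⁻ w in (Metric.ball (0 : E d) ε)ᶜ, ‖𝓕 G w‖ₑ ^ 2 / ENNReal.ofReal (σ w)
      ≤ ∫⁻ w in (Metric.ball (0 : E d) ε)ᶜ, ‖𝓕 G w‖ₑ ^ 2 * (ENNReal.ofReal m)⁻¹ := by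
    refine setLIntegral_mono' hB.compl fun w hw => ?_
    rw [div_eq_mul_inv]
    gcongr
    refine le_trans ?_ (hσ w)
    have : ε ≤ ‖w‖ := by simpa using hw
    change c * min 1 (ε ^ 2) ≤ _
    gcongr
  refine hle.trans_lt ((setLIntegral_le_lintegral _ _).trans_lt ?_)
  have hmi : (ENNReal.ofReal m)⁻¹ < ∞ := ENNReal.inv_lt_top.2 (ENNReal.ofReal_pos.2 hm)
  rw [lintegral_mul_const' _ _ hmi.ne]
  refine ENNReal.mul_lt_top ?_ hmi
  have := (memLp_fourier hG.integrable (hG.memLp 2)).eLpNorm_lt_top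
  rw [eLpNorm_lt_top_iff_lintegral_rpow_enorm_lt_top (by norm_num) (by norm_num)] at this
  simpa using this

theorem setLIntegral_fourier_div_lt_top {ε : ℝ}
    (h : ∫⁻ w in Metric.ball (0 : E d) ε, (ENNReal.ofReal (σ w))⁻¹ < ∞) (G : E d → ℂ) :
    ∫⁻ w in Metric.ball (0 : E d) ε, ‖𝓕 G w‖ₑ ^ 2 / ENNReal.ofReal (σ w) < ∞ := by
  have hle : ∫⁻ w in Metric.ball (0 : E d) ε, ‖𝓕 G w‖ₑ ^ 2 / ENNReal.ofReal (σ w)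
      ≤ ∫⁻ w in Metric.ball (0 : E d) ε,
        ENNReal.ofReal ((∫ x, ‖G x‖) ^ 2) * (ENNReal.ofReal (σ w))⁻¹ := by
    refine setLIntegral_mono' Metric.isOpen_ball.measurableSet fun w _ => ?_
    rw [div_eq_mul_inv, enorm_sq_eq_ofReal]
    gcongr
    exact norm_fourier_le G w
  refine hle.trans_lt ?_
  rw [lintegral_const_mul' _ _ ENNReal.ofReal_ne_top]
  exact ENNReal.mul_lt_top ENNReal.ofReal_lt_top h

/-- The Fourier transform of a test function of vanishing integral vanishes at the origin, and is
Lipschitz there. -/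
theorem exists_norm_fourier_le_mul_norm {G : E d → ℂ} (hG : IsTest G) (h0 : ∫ x, G x = 0) :
    ∃ C, ∀ w, ‖𝓕 G w‖ ≤ C * ‖w‖ := by
  obtain ⟨R, hR⟩ := hG.compact.isCompact.isBounded.exists_norm_le
  refine ⟨∫ x, 2 * Real.pi * R * ‖G x‖, fun w => ?_⟩
  have hi : Integrable fun v => Complex.exp (↑(-2 * Real.pi * inner ℝ v w) * Complex.I) • G v := by
    have hc : Continuous fun v : E d => Complex.exp (↑(-2 * Real.pi * inner ℝ v w) * Complex.I) := by
      fun_prop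
    refine hG.integrable.mono (hc.aestronglyMeasurable.smul hG.integrable.1)
      (Eventually.of_forall fun v => ?_)
    rw [norm_smul, Complex.norm_exp_ofReal_mul_I, one_mul]
  have e : 𝓕 G w = ∫ v, (Complex.exp (↑(-2 * Real.pi * inner ℝ v w) * Complex.I) • G v - G v) := by
    rw [integral_sub hi hG.integrable, h0, sub_zero, Real.fourier_eq']
  rw [e, ← integral_mul_const]
  refine (norm_integral_le_integral_norm _).trans (integral_mono_of_nonneg
    (Eventually.of_forall fun _ => norm_nonneg _) ((hG.integrable.norm.const_mul _).mul_const _)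
    (Eventually.of_forall fun v => ?_))
  simp only
  by_cases hv : v ∈ tsupport G
  · rw [smul_eq_mul, ← sub_one_mul, norm_mul, mul_right_comm _ ‖G v‖ ‖w‖]
    refine mul_le_mul_of_nonneg_right ?_ (norm_nonneg _)
    have h1 := Real.norm_exp_I_mul_ofReal_sub_one_le (x := -2 * Real.pi * inner ℝ v w)
    rw [mul_comm Complex.I] at h1
    refine h1.trans ?_
    rw [Real.norm_eq_abs, abs_mul, abs_mul, abs_neg, abs_two, abs_of_pos Real.pi_pos, mul_assoc _ R]
    gcongr
    refine (abs_real_inner_le_norm _ _).trans ?_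
    gcongr
    exact hR v hv
  · simp [image_eq_zero_of_notMem_tsupport hv]

/-- Test functions vanishing on a compact set can be corrected to have a prescribed integral, at an
arbitrarily small cost. -/
theorem exists_testSpace_integral_eq (hd : 0 < d) {A : Set (E d)} (hA : IsCompact A) (a : ℂ)
    {ε : ℝ} (hε : 0 < ε) :
    ∃ φ ∈ testSpace A, ∫ x, φ x = a ∧ ∫ x, ‖φ x‖ ^ 2 < ε := by
  have : Nonempty (Fin d) := ⟨⟨0, hd⟩⟩
  have hvol : Tendsto (fun n : ℕ => volume (Metric.closedBall (0 : E d) n)) atTop (𝓝 ∞) := by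
    have h := tendsto_measure_iUnion_atTop (μ := (volume : Measure (E d)))
      (s := fun n : ℕ => Metric.closedBall (0 : E d) n)
      fun m n hmn => Metric.closedBall_subset_closedBall (by exact_mod_cast hmn)
    rwa [Metric.iUnion_closedBall_nat, measure_univ_of_isAddLeftInvariant] at h
  obtain ⟨n, hn⟩ := (hvol.eventually_const_lt
    (u := volume A + ENNReal.ofReal (‖a‖ ^ 2 / ε)) (by
      exact ENNReal.add_lt_top.2 ⟨hA.measure_lt_top, ENNReal.ofReal_lt_top⟩)).exists
  -- The constant a/v on B, with v the volume of B, has integral a and squared L² norm |a|²/v. Since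
  -- d > 0, v can be made larger than |a|²/ε.
  set B := Metric.closedBall (0 : E d) n \ A
  have hBm : MeasurableSet B := Metric.isClosed_closedBall.measurableSet.diff hA.measurableSet
  have hBfin : volume B ≠ ∞ :=
    ((measure_mono Set.sdiff_subset).trans_lt measure_closedBall_lt_top).ne
  have hB : ENNReal.ofReal (‖a‖ ^ 2 / ε) < volume B := by
    have h1 : volume (Metric.closedBall (0 : E d) n) - volume A ≤ volume B := le_measure_sdiff
    exact (lt_tsub_iff_left.2 hn).trans_le h1
  set v := volume.real B
  have hv : ‖a‖ ^ 2 / ε < v := by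
    have := (ENNReal.toReal_lt_toReal ENNReal.ofReal_ne_top hBfin).2 hB
    rwa [ENNReal.toReal_ofReal (by positivity)] at this
  have hv0 : 0 < v := lt_of_le_of_lt (by positivity) hv
  refine ⟨B.indicator fun _ => a / v, ⟨⟨measurable_const.indicator hBm, ⟨‖a / v‖, fun x =>
    norm_indicator_le_norm_self (fun _ : E d => a / (v : ℂ)) x⟩, ?_⟩, fun x hx => ?_⟩, ?_, ?_⟩
  · exact HasCompactSupport.intro (isCompact_closedBall (0 : E d) n)
      fun x hx => Set.indicator_of_notMem (fun h => hx h.1) _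
  · exact Set.indicator_of_notMem (fun h => h.2 hx) _
  · rw [integral_indicator_const _ hBm, Complex.real_smul]
    exact mul_div_cancel₀ _ (by exact_mod_cast hv0.ne')
  · have e : (fun x => ‖B.indicator (fun _ => a / (v : ℂ)) x‖ ^ 2)
        = B.indicator fun _ => ‖a‖ ^ 2 / v ^ 2 := by
      funext x
      by_cases hx : x ∈ B
      · simp [hx, div_pow]
      · simp [hx]
    rw [e, integral_indicator_const _ hBm, smul_eq_mul]
    rw [div_lt_iff₀ hε] at hv
    change v * _ < _
    have : v * (‖a‖ ^ 2 / v ^ 2) = ‖a‖ ^ 2 / v := by field_simp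
    rw [this, div_lt_iff₀ hv0]
    linarith

theorem integral_norm_fourier_sq {f : E d → ℂ} (hf : IsTest f) :
    ∫ w, ‖𝓕 f w‖ ^ 2 = ∫ x, ‖f x‖ ^ 2 := by
  have h1 := integral_fourier_mul_conj hf.integrable (hf.memLp 2) hf.integrable (hf.memLp 2)
  simp only [Complex.mul_conj, Complex.normSq_eq_norm_sq] at h1
  rwa [integral_complex_ofReal, integral_complex_ofReal, Complex.ofReal_inj] at h1

theorem IsTest.integrable_norm_fourier_sq_mul {f : E d → ℂ} (hf : IsTest f) (hσ : Continuous σ)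
    (hσ0 : ∀ w, 0 ≤ σ w) (hσ2 : ∀ w, σ w ≤ 2) : Integrable fun w => ‖𝓕 f w‖ ^ 2 * σ w := by
  have hF : Integrable fun w => ‖𝓕 f w‖ ^ 2 :=
    (memLp_fourier hf.integrable (hf.memLp 2)).integrable_norm_pow (by norm_num)
  exact hF.mul_bdd (c := 2) hσ.aestronglyMeasurable
    (Eventually.of_forall fun w => by rw [Real.norm_of_nonneg (hσ0 w)]; exact hσ2 w)

/-- If `1 / σ` is not integrable at the origin, then the indicator function of a compact set is
approximated by test functions vanishing on this set and having the same integral. -/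
theorem exists_approx_indicator_of_integral_eq (hd : 0 < d) (hσ : Continuous σ)
    (hσ0 : ∀ w, 0 ≤ σ w) (hσ2 : ∀ w, σ w ≤ 2) {A : Set (E d)} (hA : IsCompact A)
    (hpole : ∀ ε > 0, ∫⁻ w in Metric.ball (0 : E d) ε, (ENNReal.ofReal (σ w))⁻¹ = ∞)
    {γ : E d → ℂ} (hγ : IsTest γ) (hγA : γ = A.indicator 1) {ε : ℝ} (hε : 0 < ε) :
    ∃ f ∈ testSpace A, ∫ x, (f x - γ x) = 0 ∧ ∫ w, ‖𝓕 (fun x => f x - γ x) w‖ ^ 2 * σ w < ε := by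
  -- The shares ε/4 and ε/8 fit the bound |a + b|² σ ≤ 2|a|² σ + 4|b|², which uses σ ≤ 2.
  obtain ⟨f, hf, hfε⟩ := exists_approx_indicator hσ hσ0 hσ2 hA hpole hγ hγA
    (show 0 < ε / 4 by positivity)
  obtain ⟨φ, hφ, hφi, hφε⟩ := exists_testSpace_integral_eq hd hA (-∫ x, (f x - γ x))
    (show 0 < ε / 8 by positivity)
  have hg := hf.1.sub hγ
  have hfun : (fun x => (f + φ) x - γ x) = fun x => (f x - γ x) + φ x := by
    funext x; simp only [Pi.add_apply]; ring
  refine ⟨f + φ, add_mem hf hφ, ?_, ?_⟩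
  · rw [hfun, integral_add hg.integrable hφ.1.integrable, hφi, add_neg_cancel]
  · rw [hfun]
    have i1 := hg.integrable_norm_fourier_sq_mul hσ hσ0 hσ2
    have i2 : Integrable fun w => ‖𝓕 φ w‖ ^ 2 :=
      (memLp_fourier hφ.1.integrable (hφ.1.memLp 2)).integrable_norm_pow (by norm_num)
    have hle : ∫ w, ‖𝓕 (fun x => (f x - γ x) + φ x) w‖ ^ 2 * σ w
        ≤ ∫ w, (2 * (‖𝓕 (fun x => f x - γ x) w‖ ^ 2 * σ w) + 4 * ‖𝓕 φ w‖ ^ 2) := by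
      refine integral_mono_of_nonneg (Eventually.of_forall fun w =>
        mul_nonneg (sq_nonneg _) (hσ0 w)) ((i1.const_mul 2).add (i2.const_mul 4))
        (Eventually.of_forall fun w => ?_)
      simp only
      rw [fourier_add_apply hg.integrable hφ.1.integrable]
      set a := 𝓕 (fun x => f x - γ x) w
      set b := 𝓕 φ w
      have h1 : ‖a + b‖ ^ 2 ≤ 2 * ‖a‖ ^ 2 + 2 * ‖b‖ ^ 2 := by
        have : ‖a + b‖ ^ 2 ≤ (‖a‖ + ‖b‖) ^ 2 := by gcongr; exact norm_add_le _ _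
        nlinarith [sq_nonneg (‖a‖ - ‖b‖)]
      have h2 := mul_le_mul_of_nonneg_right h1 (hσ0 w)
      have h3 := mul_le_mul_of_nonneg_left (hσ2 w) (sq_nonneg ‖b‖)
      linarith
    rw [integral_add (i1.const_mul 2) (i2.const_mul 4), integral_const_mul, integral_const_mul,
      integral_norm_fourier_sq hφ.1] at hle
    linarith

end FourierWeight

end RigidDPP

/-! ### Rigidity and the pole condition -/

namespace RigidDPP

open scoped FourierTransform ComplexConjugate

variable {d : ℕ} {K : E d → E d → ℂ} {Ω : Type*} [MeasurableSpace Ω] {μ : Measure Ω}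
  {P : Ω → Configuration d}

theorem sq_eLpNorm_two_eq_ofReal {X : Ω → ℂ} (hX : MemLp X 2 μ) :
    eLpNorm X 2 μ ^ 2 = ENNReal.ofReal (∫ ω, ‖X ω‖ ^ 2 ∂μ) := by
  rw [ofReal_integral_eq_lintegral_ofReal (hX.integrable_norm_pow (by norm_num))
    (Eventually.of_forall fun _ => sq_nonneg _),
    eLpNorm_eq_lintegral_rpow_enorm_toReal (by norm_num) (by norm_num),
    ← ENNReal.rpow_natCast, ← ENNReal.rpow_mul]
  simp only [ENNReal.toReal_ofNat, ENNReal.rpow_ofNat, ← enorm_sq_eq_ofReal]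
  norm_num

theorem IsTest.linStat_sub {f g : E d → ℂ} (hf : IsTest f) (hg : IsTest g) (S : Configuration d) :
    linStat (fun x => f x - g x) S = linStat f S - linStat g S :=
  (hf.summable S).tsum_sub (hg.summable S)

theorem integrable_reducedKernel_sq (hκ : MemLp (reducedKernel K) 2 volume) :
    Integrable fun z => reducedKernel K z ^ 2 := hκ.integrable_sq

theorem integral_reducedKernel_sq_le [IsProbabilityMeasure μ] (hpos : IsHermitianPositive K)
    (hK : Measurable (Function.uncurry K)) (hK0 : K 0 0 = 1) (hcorr : HasStationaryCorrelations K)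
    (hP : Measurable P) (hdet : IsDeterminantal μ P K) (hκ : MemLp (reducedKernel K) 2 volume) :
    ∫ z, reducedKernel K z ^ 2 ≤ 1 := by
  have h := lintegral_reducedKernel_sq_le hpos hK hK0 hcorr hP hdet
  rw [← ofReal_integral_eq_lintegral_ofReal (integrable_reducedKernel_sq hκ)
    (Eventually.of_forall fun _ => sq_nonneg _)] at h
  exact ENNReal.ofReal_le_one.1 h

/-- If `1 / (1 - (κ²)^)` is not integrable at the origin, then the number of points in a compact set
is a limit of linear statistics of functions vanishing on this set. -/
theorem isRigid_of_setLIntegral_eq_top [IsProbabilityMeasure μ] (hd : 0 < d)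
    (hpos : IsHermitianPositive K)
    (hK : Measurable (Function.uncurry K)) (hK0 : K 0 0 = 1) (hcorr : HasStationaryCorrelations K)
    (hP : Measurable P) (hdet : IsDeterminantal μ P K) (hκ : MemLp (reducedKernel K) 2 volume)
    {A : Set (E d)} (hA : IsCompact A)
    (hpole : ∀ ε > 0, ∫⁻ w in Metric.ball (0 : E d) ε,
      (ENNReal.ofReal (structureFactor (fun z => reducedKernel K z ^ 2) w))⁻¹ = ∞) :
    IsRigid μ P (fun _ => 1) A := by
  have hκi := integrable_reducedKernel_sq hκ
  have hm := integral_reducedKernel_sq_le hpos hK hK0 hcorr hP hdet hκ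
  have hκ0 : ∀ z, 0 ≤ reducedKernel K z ^ 2 := fun z => sq_nonneg _
  set σ := structureFactor fun z => reducedKernel K z ^ 2
  have hσ : Continuous σ := continuous_structureFactor hκi
  have hσ2 : ∀ w, σ w ≤ 2 := structureFactor_le_two hκ0 hm
  have hσ0 : ∀ w, 0 ≤ σ w := fun w => by
    obtain ⟨c, hc, h⟩ := exists_le_structureFactor hκi hκ0 hm
    exact (by positivity : 0 ≤ c * min 1 (‖w‖ ^ 2)).trans (h w)
  set γ : E d → ℂ := A.indicator fun _ => 1 with hγdef
  have hγ : IsTest γ := by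
    have h := isTest_indicator_polyEval hA 1
    have : polyEval (1 : MvPolynomial (Fin d) ℂ) = fun _ => 1 := by funext t; simp [polyEval]
    rwa [this] at h
  choose f hf hfi hfε using fun n : ℕ => exists_approx_indicator_of_integral_eq hd hσ hσ0 hσ2 hA
    hpole hγ rfl (show (0 : ℝ) < 1 / ((n : ℝ) + 1) by positivity)
  have hbound : ∀ n, eLpNorm (fun ω => linStat (f n) (P ω) - linStat γ (P ω)) 2 μ ^ 2
      ≤ ENNReal.ofReal (1 / ((n : ℝ) + 1)) := fun n => by
    obtain ⟨hmem, hint⟩ :=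
      integral_norm_linStat_sq hpos hK hK0 hcorr hP hdet hκi ((hf n).1.sub hγ)
    have h := sq_eLpNorm_two_eq_ofReal hmem
    simp only [(hf n).1.linStat_sub hγ] at h hint
    -- The integral of f n - γ is zero, so only the term weighted by σ is left of the second moment.
    rw [h, hint, hfi, norm_zero]
    refine ENNReal.ofReal_le_ofReal ?_
    have := (hfε n).le
    simpa using this
  have hlim : Tendsto (fun n => eLpNorm (fun ω => linStat (f n) (P ω) - linStat γ (P ω)) 2 μ)
      atTop (𝓝 0) := by
    have h0 : Tendsto (fun n : ℕ => ENNReal.ofReal (1 / ((n : ℝ) + 1))) atTop (𝓝 0) := by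
      rw [← ENNReal.ofReal_zero]
      exact ENNReal.tendsto_ofReal tendsto_one_div_add_atTop_nhds_zero_nat
    have h1 := tendsto_of_tendsto_of_tendsto_of_le_of_le tendsto_const_nhds h0
      (fun n => zero_le) hbound
    have h2 := (ENNReal.continuous_rpow_const (y := (1 / 2 : ℝ))).tendsto 0 |>.comp h1
    rw [ENNReal.zero_rpow_of_pos (by norm_num)] at h2
    refine h2.congr fun n => ?_
    simp only [Function.comp]
    rw [← ENNReal.rpow_natCast, ← ENNReal.rpow_mul]
    norm_num
  have hmeas : ∀ g : E d → ℂ, IsTest g → AEStronglyMeasurable (fun ω => linStat g (P ω)) μ :=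
    fun g hg => (integral_norm_linStat_sq hpos hK hK0 hcorr hP hdet hκi hg).1.1
  -- L² convergence gives almost sure convergence only along a subsequence, which is the sequence
  -- finally used.
  obtain ⟨ns, hns, hae⟩ := (tendstoInMeasure_of_tendsto_eLpNorm (by norm_num)
    (fun n => hmeas _ (hf n).1) (hmeas _ hγ) hlim).exists_seq_tendsto_ae
  exact ⟨fun n => f (ns n), fun n => ⟨(hf _).1.measurable, (hf _).1.bounded, (hf _).1.compact,
    fun x hx hxA => hx ((hf _).2 x hxA)⟩, hae, hlim.comp hns.tendsto_atTop⟩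

/-- Rigidity forces orthogonality to all test functions `G` living on `A` whose Fourier transform is
square integrable with respect to `1 / (1 - (κ²)^)`. -/
theorem IsRigid.integral_mul_conj_eq_zero [IsProbabilityMeasure μ] (hd : 0 < d)
    (hpos : IsHermitianPositive K)
    (hK : Measurable (Function.uncurry K)) (hK0 : K 0 0 = 1) (hcorr : HasStationaryCorrelations K)
    (hP : Measurable P) (hdet : IsDeterminantal μ P K) (hκ : MemLp (reducedKernel K) 2 volume)
    {A : Set (E d)} {γ : E d → ℂ} (hrigid : IsRigid μ P γ A) (hγ : IsTest (A.indicator γ))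
    {G : E d → ℂ} (hG : IsTest G) (hGA : ∀ x ∉ A, G x = 0)
    (hfin : ∫⁻ w, ‖𝓕 G w‖ₑ ^ 2 /
      ENNReal.ofReal (structureFactor (fun z => reducedKernel K z ^ 2) w) < ∞) :
    ∫ x, A.indicator γ x * conj (G x) = 0 := by
  have : Nonempty (Fin d) := ⟨⟨0, hd⟩⟩
  have hκi := integrable_reducedKernel_sq hκ
  have hm := integral_reducedKernel_sq_le hpos hK hK0 hcorr hP hdet hκ
  have hκ0 : ∀ z, 0 ≤ reducedKernel K z ^ 2 := fun z => sq_nonneg _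
  set σ := structureFactor fun z => reducedKernel K z ^ 2
  have hσ : Continuous σ := continuous_structureFactor hκi
  have hσ2 : ∀ w, σ w ≤ 2 := structureFactor_le_two hκ0 hm
  obtain ⟨c, hc, hcσ⟩ := exists_le_structureFactor hκi hκ0 hm
  have hσ0 : ∀ w, 0 ≤ σ w := fun w =>
    (by positivity : 0 ≤ c * min 1 (‖w‖ ^ 2)).trans (hcσ w)
  have hσpos : ∀ᵐ w : E d, 0 < σ w := by
    filter_upwards [Measure.ae_ne volume (0 : E d)] with w hw
    have : 0 < ‖w‖ := norm_pos_iff.2 hw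
    exact (by positivity : 0 < c * min 1 (‖w‖ ^ 2)).trans_le (hcσ w)
  obtain ⟨f, hf, -, hlim⟩ := hrigid
  have hft : ∀ n, IsTest (f n) := fun n => ⟨(hf n).1, (hf n).2.1, (hf n).2.2.1⟩
  have hbound : ∀ n, ‖∫ x, A.indicator γ x * conj (G x)‖ₑ ^ 2
      ≤ eLpNorm (fun ω => linStat (f n) (P ω) - linStat (A.indicator γ) (P ω)) 2 μ ^ 2
        * ∫⁻ w, ‖𝓕 G w‖ₑ ^ 2 / ENNReal.ofReal (σ w) := fun n => by
    have ht := (hft n).sub hγ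
    have e : ‖∫ x, A.indicator γ x * conj (G x)‖ₑ
        -- f n vanishes on A and G vanishes off A, so subtracting f n does not change the pairing
        -- with G.
        = ‖∫ x, (f n x - A.indicator γ x) * conj (G x)‖ₑ := by
      rw [← enorm_neg, ← integral_neg]
      congr 1
      refine integral_congr_ae (Eventually.of_forall fun x => ?_)
      simp only
      by_cases hx : x ∈ A
      · have : f n x = 0 := by
          by_contra h
          exact (hf n).2.2.2 h hx
        rw [this]; ring
      · rw [hGA x hx]; simp
    rw [e]
    refine (enorm_integral_mul_conj_sq_le hσ hσpos ht hG).trans ?_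
    gcongr
    obtain ⟨hmem, hint⟩ := integral_norm_linStat_sq hpos hK hK0 hcorr hP hdet hκi ht
    have h := sq_eLpNorm_two_eq_ofReal hmem
    simp only [(hft n).linStat_sub hγ] at h hint
    rw [h, hint]
    calc ∫⁻ w, ‖𝓕 (fun x => f n x - A.indicator γ x) w‖ₑ ^ 2 * ENNReal.ofReal (σ w)
        = ENNReal.ofReal (∫ w, ‖𝓕 (fun x => f n x - A.indicator γ x) w‖ ^ 2 * σ w) := by
          rw [ofReal_integral_eq_lintegral_ofReal (ht.integrable_norm_fourier_sq_mul hσ hσ0 hσ2)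
            (Eventually.of_forall fun w => mul_nonneg (sq_nonneg _) (hσ0 w))]
          refine lintegral_congr fun w => ?_
          rw [enorm_sq_eq_ofReal, ENNReal.ofReal_mul (sq_nonneg _)]
      _ ≤ _ := ENNReal.ofReal_le_ofReal (le_add_of_nonneg_left (sq_nonneg _))
  have hlim2 : Tendsto (fun n =>
      eLpNorm (fun ω => linStat (f n) (P ω) - linStat (A.indicator γ) (P ω)) 2 μ ^ 2
        * ∫⁻ w, ‖𝓕 G w‖ₑ ^ 2 / ENNReal.ofReal (σ w)) atTop (𝓝 0) := by
    have h1 := ((ENNReal.continuous_pow 2).tendsto 0).comp hlim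
    have h2 := ENNReal.Tendsto.mul_const h1 (Or.inr hfin.ne)
    simpa using h2
  have h0 := ge_of_tendsto' hlim2 hbound
  simpa using h0

/-- If `(1 - (κ²)^)⁻¹` has no pole of order `k` at the origin, then the process is not rigid for any
`k`-polynomial. -/
theorem not_isPolyRigid_of_not_hasPole [IsProbabilityMeasure μ] (hd : 0 < d)
    (hpos : IsHermitianPositive K)
    (hK : Measurable (Function.uncurry K)) (hK0 : K 0 0 = 1) (hcorr : HasStationaryCorrelations K)
    (hP : Measurable P) (hdet : IsDeterminantal μ P K) (hκ : MemLp (reducedKernel K) 2 volume)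
    {A : Set (E d)} (hA : IsCompact A) (hAint : (interior A).Nonempty) {k : Fin d →₀ ℕ}
    (hk : ¬ HasPole (spectralDensity K) k) {Q : MvPolynomial (Fin d) ℂ}
    (hQ : IsMultiPolynomial k Q) : ¬ IsPolyRigid μ P Q A := by
  intro hrigid
  have hκi := integrable_reducedKernel_sq hκ
  have hm := integral_reducedKernel_sq_le hpos hK hK0 hcorr hP hdet hκ
  obtain ⟨c, hc, hcσ⟩ := exists_le_structureFactor hκi (fun z => sq_nonneg _) hm
  have hσm := (continuous_structureFactor hκi).measurable
  obtain ⟨k₀, hk₀, hcoeff, -⟩ := hQ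
  have hQA := isTest_indicator_polyEval hA Q
  have horth : ∀ m : ℂ, (∫⁻ w, ‖𝓕 (A.indicator (polyEval (Q - MvPolynomial.C m))) w‖ₑ ^ 2 /
      ENNReal.ofReal (structureFactor (fun z => reducedKernel K z ^ 2) w) < ∞) →
      ∫ x, A.indicator (polyEval Q) x
        * conj (A.indicator (polyEval (Q - MvPolynomial.C m)) x) = 0 := fun m hfin =>
    IsRigid.integral_mul_conj_eq_zero hd hpos hK hK0 hcorr hP hdet hκ hrigid hQA
      (isTest_indicator_polyEval hA _) (fun x hx => Set.indicator_of_notMem hx _) hfin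
  rcases eq_or_ne k 0 with rfl | hk0
  -- Order 0: 1/σ is integrable at 0 and 𝓕 G is bounded, so G = 1_A Q itself, with m = 0, is
  -- admissible.
  · obtain ⟨ε, hε, hlt⟩ := exists_setLIntegral_lt_top_of_not_hasPole hk
    simp_rw [spectralDensity_eq] at hlt
    have hr : 0 < (2 * Real.pi)⁻¹ := by positivity
    rw [setLIntegral_ball_smul (F := fun w => (ENNReal.ofReal
      (structureFactor (fun z => reducedKernel K z ^ 2) w))⁻¹) (by fun_prop) hr] at hlt
    have hlt' := ENNReal.lt_top_of_mul_ne_top_right hlt.ne (by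
      refine (ENNReal.ofReal_pos.2 ?_).ne'
      positivity)
    have h := horth 0 (lintegral_fourier_div_lt_top hc hcσ (isTest_indicator_polyEval hA _)
      (by positivity) (setLIntegral_fourier_div_lt_top hlt' _))
    rw [map_zero, sub_zero] at h
    have := eq_zero_of_integral_mul_conj_eq_zero hA hAint h
    simp [this] at hcoeff
  · set V := volume.real A
    have hV : V ≠ 0 := by
      have : 0 < volume A :=
        (isOpen_interior.measure_pos volume hAint).trans_le (measure_mono interior_subset)
      exact (ENNReal.toReal_pos this.ne' hA.measure_lt_top.ne).ne'
    -- Subtracting the mean over A makes 𝓕 G vanish at 0 to first order, so G = 1_A (Q - m) is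
    -- admissible by the lower bound on σ alone.
    set m : ℂ := (∫ x, A.indicator (polyEval Q) x) / V
    have hone : IsTest (A.indicator fun _ => m) := by
      have h := isTest_indicator_polyEval hA (MvPolynomial.C m)
      have : polyEval (MvPolynomial.C m) = fun _ : E d => m := by funext t; simp [polyEval]
      rwa [this] at h
    have hsplit : ∀ x, A.indicator (polyEval (Q - MvPolynomial.C m)) x
        = A.indicator (polyEval Q) x - A.indicator (fun _ => m) x := fun x => by
      by_cases hx : x ∈ A <;> simp [hx, polyEval]
    have hT := isTest_indicator_polyEval hA (Q - MvPolynomial.C m)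
    have hzero : ∫ x, A.indicator (polyEval (Q - MvPolynomial.C m)) x = 0 := by
      simp_rw [hsplit]
      rw [integral_sub hQA.integrable hone.integrable, integral_indicator_const _ hA.measurableSet,
        Complex.real_smul]
      change _ - (V : ℂ) * m = 0
      rw [mul_div_cancel₀ _ (by exact_mod_cast hV), sub_self]
    obtain ⟨C, hC⟩ := exists_norm_fourier_le_mul_norm hT hzero
    have h := horth m (lintegral_fourier_div_lt_top hc hcσ hT one_pos
      (setLIntegral_ball_one_lt_top hc hcσ fun w _ => hC w))
    have h2 : ∫ x, A.indicator (fun _ => m) x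
        * conj (A.indicator (polyEval (Q - MvPolynomial.C m)) x) = 0 := by
      have e : ∀ x, A.indicator (fun _ => m) x
          * conj (A.indicator (polyEval (Q - MvPolynomial.C m)) x)
          = m * conj (A.indicator (polyEval (Q - MvPolynomial.C m)) x) := fun x => by
        by_cases hx : x ∈ A <;> simp [hx]
      simp_rw [e]
      rw [integral_const_mul, integral_conj, hzero, map_zero, mul_zero]
    have hbi : ∀ {g : E d → ℂ}, IsTest g → Integrable fun x =>
        g x * conj (A.indicator (polyEval (Q - MvPolynomial.C m)) x) := fun {g} hg => by
      obtain ⟨D, hD⟩ := hg.bounded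
      have hc : IsTest fun x => conj (A.indicator (polyEval (Q - MvPolynomial.C m)) x) :=
        hT.comp_norm_le (φ := conj) (by fun_prop) (by simp)
      exact hc.integrable.bdd_mul hg.measurable.aestronglyMeasurable (Eventually.of_forall hD)
    -- G is orthogonal to 1_A Q by rigidity and to 1_A m because its mean is zero, hence to itself.
    have h3 : ∫ x, A.indicator (polyEval (Q - MvPolynomial.C m)) x
        * conj (A.indicator (polyEval (Q - MvPolynomial.C m)) x) = 0 := by
      have := integral_sub (hbi hQA) (hbi hone)
      rw [h, h2, sub_zero] at this
      rw [← this]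
      refine integral_congr_ae (Eventually.of_forall fun x => ?_)
      simp only [← sub_mul]
      rw [← hsplit]
    have h4 := eq_zero_of_integral_mul_conj_eq_zero hA hAint h3
    have hk₀0 : 0 ≠ k₀ := fun h => hk0 (le_antisymm (h ▸ hk₀) zero_le)
    have h5 : Q.coeff k₀ = 0 := by
      rw [sub_eq_zero.1 h4, MvPolynomial.coeff_C, if_neg hk₀0]
    exact hcoeff h5

/-- A pole of the density `(1 - (κ²)^)⁻¹` yields rigidity. -/
theorem isMultiRigid_of_hasPole [IsProbabilityMeasure μ] (hd : 0 < d)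
    (hpos : IsHermitianPositive K)
    (hK : Measurable (Function.uncurry K)) (hK0 : K 0 0 = 1) (hcorr : HasStationaryCorrelations K)
    (hP : Measurable P) (hdet : IsDeterminantal μ P K) (hκ : MemLp (reducedKernel K) 2 volume)
    {A : Set (E d)} (hA : IsCompact A) {k : Fin d →₀ ℕ}
    (hk : HasPole (spectralDensity K) k) : IsMultiRigid μ P k A := by
  have hκi := integrable_reducedKernel_sq hκ
  have hm := integral_reducedKernel_sq_le hpos hK hK0 hcorr hP hdet hκ
  obtain ⟨c, hc, hcσ⟩ := exists_le_structureFactor hκi (fun z => sq_nonneg _) hm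
  have hσm := (continuous_structureFactor hκi).measurable
  have hr : 0 < (2 * Real.pi)⁻¹ := by positivity
  have hr1 : (2 * Real.pi)⁻¹ ≤ 1 := inv_le_one_of_one_le₀ (by linarith [Real.pi_gt_three])
  have hs : ∀ u : E d, c * (2 * Real.pi)⁻¹ ^ 2 * min 1 (‖u‖ ^ 2) ≤ spectralDensity K u := fun u => by
    rw [spectralDensity_eq]
    refine le_trans ?_ (hcσ _)
    rw [norm_smul, Real.norm_of_nonneg hr.le, mul_pow, mul_assoc]
    gcongr
    refine le_min ?_ ?_
    · exact mul_le_one₀ (pow_le_one₀ hr.le hr1) (by positivity) (min_le_left _ _)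
    · gcongr; exact min_le_right _ _
  -- The quadratic lower bound leaves order 0 as the only case.
  obtain rfl := hk.eq_zero (by positivity) hs
  have hpole : ∀ ε > 0, ∫⁻ w in Metric.ball (0 : E d) ε,
      (ENNReal.ofReal (structureFactor (fun z => reducedKernel K z ^ 2) w))⁻¹ = ∞ := fun ε hε => by
    have h := hk.setLIntegral_eq_top (ε := (2 * Real.pi) * ε) (by positivity)
    simp_rw [spectralDensity_eq] at h
    rw [setLIntegral_ball_smul (F := fun w => (ENNReal.ofReal
      (structureFactor (fun z => reducedKernel K z ^ 2) w))⁻¹) (by fun_prop) hr,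
      inv_mul_cancel_left₀ (by positivity)] at h
    by_contra hfin
    exact ENNReal.mul_ne_top ENNReal.ofReal_ne_top hfin h
  have h := isRigid_of_setLIntegral_eq_top hd hpos hK hK0 hcorr hP hdet hκ hA hpole
  simpa [IsMultiRigid] using h

end RigidDPP

theorem corollary4p1 {d : ℕ} (hd : 0 < d)
    {Ω : Type*} [MeasurableSpace Ω] (μ : Measure Ω) [IsProbabilityMeasure μ]
    (P : Ω → RigidDPP.Configuration d) (hP : Measurable P)
    (K : RigidDPP.E d → RigidDPP.E d → ℂ) (hK : Measurable (Function.uncurry K))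
    (hpos : RigidDPP.IsHermitianPositive K) (hK0 : K 0 0 = 1)
    (hdet : RigidDPP.IsDeterminantal μ P K)
    (hstat : RigidDPP.IsStationary μ P) (hcorr : RigidDPP.HasStationaryCorrelations K)
    (hκ : MemLp (RigidDPP.reducedKernel K) 2 volume)
    (A : Set (RigidDPP.E d)) (hA : IsCompact A) (hAconv : Convex ℝ A)
    (hAint : (interior A).Nonempty) (k : Fin d →₀ ℕ) :
    (RigidDPP.IsMultiRigid μ P k A ↔ RigidDPP.HasPole (RigidDPP.spectralDensity K) k) ∧
    (¬ RigidDPP.HasPole (RigidDPP.spectralDensity K) k →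
      ∀ Q : MvPolynomial (Fin d) ℂ, RigidDPP.IsMultiPolynomial k Q →
        ¬ RigidDPP.IsPolyRigid μ P Q A) := by
  have hnot : ¬ RigidDPP.HasPole (RigidDPP.spectralDensity K) k →
      ∀ Q : MvPolynomial (Fin d) ℂ, RigidDPP.IsMultiPolynomial k Q →
        ¬ RigidDPP.IsPolyRigid μ P Q A := fun hk Q hQ =>
    RigidDPP.not_isPolyRigid_of_not_hasPole hd hpos hK hK0 hcorr hP hdet hκ hA hAint hk hQ
  refine ⟨⟨fun h => ?_, RigidDPP.isMultiRigid_of_hasPole hd hpos hK hK0 hcorr hP hdet hκ hA⟩, hnot⟩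
  by_contra hk
  -- The monomial t^k is itself a k-polynomial, with k₀ = k, so the second assertion yields the
  -- remaining implication.
  refine hnot hk (MvPolynomial.monomial k 1) ⟨k, le_rfl, by simp, fun m hm => ?_⟩ ?_
  · rw [MvPolynomial.coeff_monomial] at hm
    by_contra hmk
    exact hm (if_neg fun h => hmk h.ge)
  · rw [RigidDPP.IsPolyRigid, show RigidDPP.polyEval (MvPolynomial.monomial k 1)
      = fun t : RigidDPP.E d => ∏ i, ((t i : ℝ) : ℂ) ^ k i from
      funext (RigidDPP.polyEval_monomial k)]
    exact h
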